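/- Let $m\ge 1$ and let $\mathcal S_m$ be the metric star graph consisting of $m$ half-lines $[0,\infty)$ glued at $0$. Let $\mu_m$ be the probability measure on $\mathcal S_m$ with density $\frac{2}{m\sqrt\pi}e^{-x^2}$ with respect to Lebesgue measure on each ray, and let $L^2_{\mu_m}(\mathcal S_m)=\bigoplus_{i=1}^m L^2_{\mu_m}(\mathbb R_+,i)$ (complex-valued functions $f=(f_i)_{1\le i\le m}$). Let $A_2$ be the operator $$D(A_2)=\Big\{f\in\bigoplus_{i=1}^m H^2_{\mu_m}(\mathbb R_+,i):\ f_i(0)=f_j(0)\text{ for all }i,j,\ \sum_{i=1}^m f_i'(0)=0\Big\},\qquad (A_2f)_i(x)=\tfrac12 f_i''(x)-xf_i'(x),$$ where $H^2_{\mu_m}(\mathbb R_+,i)$ is the space of $f_i\in L^2_{\mu_m}(\mathbb R_+,i)$ whose weak derivatives $f_i',f_i''$ are in $L^2_{\mu_m}(\mathbb R_+,i)$. Then $A_2$ is the generator of the Ornstein–Uhlenbeck semigroup $(S_m(t))_{t\ge0}$ on $L^2_{\mu_m}(\mathcal S_m)$, i.e. of the strongly continuous semigroup with $S_m(0)=I$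 that is given for $t>0$, $1\le i\le m$ and a.e. $x>0$ by $$\begin{aligned}(S_m(t)f)_i(x)={}&\frac{1}{\sqrt{\pi(1-e^{-2t})}}\int_0^\infty\Big(e^{-\frac{(e^{-t}x-y)^2}{1-e^{-2t}}}-e^{-\frac{(e^{-t}x+y)^2}{1-e^{-2t}}}\Big)f_i(y)\,dy\\&+\frac{2}{m\sqrt{\pi(1-e^{-2t})}}\sum_{j=1}^m\int_0^\infty e^{-\frac{(e^{-t}x+y)^2}{1-e^{-2t}}}f_j(y)\,dy,\end{aligned}$$ and for every $t>0$ the operator $S_m(t)$ is of trace class on $L^2_{\mu_m}(\mathcal S_m)$, i.e. $\sum_n\langle |S_m(t)|e_n,e_n\rangle<\infty$ for every orthonormal basis $(e_n)$, where $|S|=(S^*S)^{1/2}$. -/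

import Mathlib

open MeasureTheory Filter Topology
open scoped ContDiff InnerProductSpace

noncomputable section

namespace StarOU

/-- The restriction of `μ_m` to one ray `(ℝ₊, i)`: density `2 / (m √π) · exp (-x²)` with respect to
Lebesgue measure on the half-line. -/
def rayMeasure (m : ℕ) : Measure ℝ :=
  (volume.restrict (Set.Ioi (0 : ℝ))).withDensity
    (fun x => ENNReal.ofReal (2 / (m * √Real.pi) * Real.exp (-x ^ 2)))

/-- The space of complex square integrable functions on one ray. -/
abbrev RayL2 (m : ℕ) : Type := Lp ℂ 2 (rayMeasure m)

/-- `L²_{μ_m}(S_m)`: the Hilbert direct sum of the `L²` spaces of the `m` rays; an element is a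
family `(f_i)` with squared norm `∑ i, ‖f_i‖²`. -/
abbrev StarL2 (m : ℕ) : Type := PiLp 2 (fun _ : Fin m => RayL2 m)

/-- `g` is the weak derivative of `f` on the open half-line `(0, ∞)`. -/
def IsWeakDeriv (f g : ℝ → ℂ) : Prop :=
  ∀ φ : ℝ → ℝ, ContDiff ℝ ∞ φ → HasCompactSupport φ → tsupport φ ⊆ Set.Ioi 0 →
    ∫ x in Set.Ioi (0 : ℝ), f x * ((deriv φ x : ℝ) : ℂ)
      = -∫ x in Set.Ioi (0 : ℝ), g x * ((φ x : ℝ) : ℂ)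

/-- The boundary value `f(0) = c`: `f` has a representative that is continuous on `[0, ∞)` and takes
the value `c` at `0`. -/
def HasValueAtZero (f : ℝ → ℂ) (c : ℂ) : Prop :=
  ∃ F : ℝ → ℂ, ContinuousOn F (Set.Ici 0) ∧ F =ᵐ[volume.restrict (Set.Ioi 0)] f ∧ F 0 = c

/-- `f` belongs to the direct sum of the weighted spaces `H²` of the rays, with edgewise first and
second weak derivatives `f₁` and `f₂` (both again square integrable). -/
def HasDerivs {m : ℕ} (f f₁ f₂ : StarL2 m) : Prop :=
  ∀ i, IsWeakDeriv (f i) (f₁ i) ∧ IsWeakDeriv (f₁ i) (f₂ i)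

/-- The domain of the Ornstein–Uhlenbeck operator `A₂`: edgewise `H²` functions that are continuous
at the centre and satisfy the Kirchhoff condition there. -/
def domainA₂ (m : ℕ) : Set (StarL2 m) :=
  {f | ∃ f₁ f₂ : StarL2 m, HasDerivs f f₁ f₂ ∧
    (∃ c : ℂ, ∀ i, HasValueAtZero (f i) c) ∧
    (∃ d : Fin m → ℂ, (∀ i, HasValueAtZero (f₁ i) (d i)) ∧ ∑ i, d i = 0)}

/-- `g = A₂ f`, that is, `g_i(x) = f_i''(x) / 2 - x f_i'(x)` on every ray. -/
def IsA₂Value {m : ℕ} (f g : StarL2 m) : Prop :=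
  ∃ f₁ f₂ : StarL2 m, HasDerivs f f₁ f₂ ∧
    ∀ i, ∀ᵐ x ∂(rayMeasure m), g i x = (1 / 2 : ℂ) * f₂ i x - (x : ℂ) * f₁ i x

/-- The integral formula for the Ornstein–Uhlenbeck semigroup on the star with `m` rays: the value
of `S_m(t) f` at the point `x` of the ray `i`. -/
def ouFormula {m : ℕ} (t : ℝ) (f : StarL2 m) (i : Fin m) (x : ℝ) : ℂ :=
  ((1 / √(Real.pi * (1 - Real.exp (-2 * t))) : ℝ) : ℂ) *
      (∫ y in Set.Ioi (0 : ℝ),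
        ((Real.exp (-(1 - Real.exp (-2 * t))⁻¹ * (Real.exp (-t) * x - y) ^ 2)
          - Real.exp (-(1 - Real.exp (-2 * t))⁻¹ * (Real.exp (-t) * x + y) ^ 2) : ℝ) : ℂ) * f i y)
    + ((2 / (m * √(Real.pi * (1 - Real.exp (-2 * t)))) : ℝ) : ℂ) *
      ∑ j, ∫ y in Set.Ioi (0 : ℝ),
        ((Real.exp (-(1 - Real.exp (-2 * t))⁻¹ * (Real.exp (-t) * x + y) ^ 2) : ℝ) : ℂ) * f j y

/-- `T` is the Ornstein–Uhlenbeck semigroup `S_m(·)` realized on `L²_{μ_m}(S_m)`: for `t > 0` it is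
given by the integral formula (and `T 0` is the identity). -/
def IsOUSemigroup {m : ℕ} (T : ℝ → StarL2 m →L[ℂ] StarL2 m) : Prop :=
  T 0 = 1 ∧
    ∀ t, 0 < t → ∀ f : StarL2 m, ∀ i, ∀ᵐ x ∂(rayMeasure m), T t f i x = ouFormula t f i x

section Abstract

universe u

variable {H : Type u} [NormedAddCommGroup H] [InnerProductSpace ℂ H]

/-- A strongly continuous one-parameter semigroup of bounded operators; only the values `T t` with
`t ≥ 0` matter. -/
structure IsC₀Semigroup (T : ℝ → H →L[ℂ] H) : Prop where
  zero : T 0 = 1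
  add : ∀ s t, 0 ≤ s → 0 ≤ t → T (s + t) = T s * T t
  tendsto : ∀ f, Tendsto (fun t => T t f) (𝓝[>] 0) (𝓝 f)

/-- `f` is in the domain of the generator of `T`, and the generator sends it to `g`. -/
def IsGeneratorValue (T : ℝ → H →L[ℂ] H) (f g : H) : Prop :=
  Tendsto (fun t : ℝ => ((t⁻¹ : ℝ) : ℂ) • (T t f - f)) (𝓝[>] 0) (𝓝 g)

/-- `S` is of trace class: `∑ ⟨e, |S| e⟩` converges for every orthonormal basis, where
`|S| = (S* S)^{1/2}`. -/
def IsTraceClass [CompleteSpace H] (S : H →L[ℂ] H) : Prop :=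
  ∀ (ι : Type u) (b : HilbertBasis ι ℂ H), Summable fun i => ⟪b i, CFC.abs S (b i)⟫_ℂ

end Abstract

/-- The generator of `T` is the operator `A₂`, with the same domain. -/
def IsGeneratedByA₂ {m : ℕ} (T : ℝ → StarL2 m →L[ℂ] StarL2 m) : Prop :=
  (∀ f, (∃ g, IsGeneratorValue T f g) ↔ f ∈ domainA₂ m) ∧
    ∀ f g, IsGeneratorValue T f g → IsA₂Value f g

end StarOU

end

/-! Diagonalise everything in one explicit Hilbert basis. Choose an orthonormal basis `w` of `ℂ^m`
whose vector `w k₀` is constant, so that the coordinates of every other `w k` sum to zero. Along `w`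
the vertex conditions decouple: continuity says that the mean-zero components vanish at `0`, and the
Kirchhoff condition says that the derivative of the constant component vanishes at `0`. The operator
thus splits into a Neumann and `m - 1` Dirichlet Ornstein–Uhlenbeck operators on the half-line, with
the even and the odd Hermite polynomials as eigenfunctions and eigenvalue `-N` in degree `N`. The
vectors `w k ⊗ H_N`, with `N` of the parity belonging to `k`, form a Hilbert basis
(`exists_hermiteBasis`), since Hermite polynomials of one parity are orthogonal and complete on the
half-line.

`T t` is defined as the operator with eigenvalues `exp (-N t)`. Strong continuity, the generator
(multiplication of coefficients by `-N`, on its maximal domain) and trace class (`∑ exp (-N t) < ∞`)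
then follow from facts about diagonal operators.

The integral formula acts on the constant component with the sum of the direct and the reflected
Gaussian kernel, and on the others with their difference. Both are foldings of the Mehler kernel on
the line, which multiplies `H_N` by `exp (-N t)` (`ouFormula_tens`). Density extends the formula to
all `f`.

For the domain, two integrations by parts against the basis express the coefficients of `f''`
through those of `f`, the vertex conditions removing the boundary terms; hence `N * c_N` is square
summable (`summable_of_mem_domain`). Conversely, that summability lets the Hermite series be
differentiated twice term by term, and the relations "is a primitive of" and `g = v / 2 - x u` are
closed in `L²` (`exists_derivatives_of_coeff`). -/

noncomputable section

namespace StarOU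

/-! ### Diagonal operators and semigroups in a Hilbert basis. -/

section Diagonal

variable {ι : Type*} {H : Type*} [NormedAddCommGroup H] [InnerProductSpace ℂ H]

theorem hasSum_norm_sq_coeff (b : HilbertBasis ι ℂ H) (f : H) :
    HasSum (fun i => ‖⟪b i, f⟫_ℂ‖ ^ 2) (‖f‖ ^ 2) := by
  have h := b.hasSum_inner_mul_inner f f
  have h2 := h.mapL Complex.reCLM
  convert! h2 using 1
  · funext i
    rw [Complex.reCLM_apply, ← inner_conj_symm f (b i), ← Complex.normSq_eq_conj_mul_self,
      Complex.ofReal_re, Complex.normSq_eq_norm_sq]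
  · rw [Complex.reCLM_apply, inner_self_eq_norm_sq_to_K]
    norm_cast

theorem ext_coeff (b : HilbertBasis ι ℂ H) {f g : H} (h : ∀ i, ⟪b i, f⟫_ℂ = ⟪b i, g⟫_ℂ) :
    f = g := by
  apply b.repr.injective
  ext i
  simpa only [b.repr_apply_apply] using h i

theorem exists_of_coeff (b : HilbertBasis ι ℂ H) {c : ι → ℂ}
    (hc : Summable fun i => ‖c i‖ ^ 2) : ∃ g : H, ∀ i, ⟪b i, g⟫_ℂ = c i := by
  have hm : Memℓp c 2 := memℓp_gen (by simpa using hc)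
  refine ⟨b.repr.symm ⟨c, hm⟩, fun i => ?_⟩
  rw [← b.repr_apply_apply, LinearIsometryEquiv.apply_symm_apply]

theorem exists_diagonal (b : HilbertBasis ι ℂ H) (a : ι → ℂ) (ha : ∀ i, ‖a i‖ ≤ 1) :
    ∃ S : H →L[ℂ] H, ∀ i f, ⟪b i, S f⟫_ℂ = a i * ⟪b i, f⟫_ℂ := by
  have hle : ∀ (f : H) i, ‖a i * ⟪b i, f⟫_ℂ‖ ^ 2 ≤ ‖⟪b i, f⟫_ℂ‖ ^ 2 := fun f i => by
    rw [norm_mul]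
    gcongr
    exact mul_le_of_le_one_left (norm_nonneg _) (ha i)
  have hex : ∀ f : H, ∃ g : H, ∀ i, ⟪b i, g⟫_ℂ = a i * ⟪b i, f⟫_ℂ := fun f =>
    exists_of_coeff b (Summable.of_nonneg_of_le (fun i => by positivity) (hle f)
      (hasSum_norm_sq_coeff b f).summable)
  choose S hS using hex
  let L : H →ₗ[ℂ] H :=
    { toFun := S
      map_add' := fun f g => ext_coeff b fun i => by simp only [hS, inner_add_right]; ring
      map_smul' := fun c f => ext_coeff b fun i => by
        simp only [hS, inner_smul_right, RingHom.id_apply]; ring }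
  refine ⟨L.mkContinuous 1 fun f => ?_, fun i f => hS f i⟩
  rw [one_mul]
  refine le_of_sq_le_sq ?_ (norm_nonneg _)
  refine hasSum_le (fun i => ?_) (hasSum_norm_sq_coeff b (S f)) (hasSum_norm_sq_coeff b f)
  rw [hS]
  exact hle f i

/-- Dominated convergence in the Parseval series of `F t - f`: one summable bound on the squared
errors upgrades coefficientwise convergence to convergence in norm. -/
theorem tendsto_of_coeff {l : Filter ℝ} [l.IsCountablyGenerated]
    (b : HilbertBasis ι ℂ H) {F : ℝ → H} {f : H} {B : ι → ℝ} (hB : Summable B)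
    (hle : ∀ᶠ t in l, ∀ i, ‖⟪b i, F t - f⟫_ℂ‖ ^ 2 ≤ B i)
    (hlim : ∀ i, Tendsto (fun t => ⟪b i, F t⟫_ℂ) l (𝓝 ⟪b i, f⟫_ℂ)) :
    Tendsto F l (𝓝 f) := by
  have h1 : Tendsto (fun t => ∑' i, ‖⟪b i, F t - f⟫_ℂ‖ ^ 2) l (𝓝 (∑' _ : ι, (0 : ℝ))) := by
    refine tendsto_tsum_of_dominated_convergence hB (fun i => ?_) ?_
    · have : Tendsto (fun t => ‖⟪b i, F t⟫_ℂ - ⟪b i, f⟫_ℂ‖ ^ 2) l (𝓝 (‖(0 : ℂ)‖ ^ 2)) :=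
        ((tendsto_sub_nhds_zero_iff.2 (hlim i)).norm).pow 2
      simpa [inner_sub_right] using this
    · filter_upwards [hle] with t ht i
      simpa using ht i
  have h2 : Tendsto (fun t => ‖F t - f‖ ^ 2) l (𝓝 0) := by
    simpa only [(hasSum_norm_sq_coeff b _).tsum_eq, tsum_zero] using h1
  have h3 := h2.sqrt
  simp only [Real.sqrt_sq (norm_nonneg _), Real.sqrt_zero] at h3
  exact tendsto_iff_norm_sub_tendsto_zero.2 h3

theorem hasDerivAt_exp_neg_mul (r : ℝ) :
    HasDerivAt (fun t : ℝ => Real.exp (-(r * t))) (-r) 0 := by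
  have := (((hasDerivAt_id (0 : ℝ)).const_mul r).neg).exp
  simpa using this

theorem tendsto_slope_exp (r : ℝ) :
    Tendsto (fun t : ℝ => t⁻¹ * (Real.exp (-(r * t)) - 1)) (𝓝[>] 0) (𝓝 (-r)) := by
  have h := (hasDerivAt_exp_neg_mul r).tendsto_slope_zero_right
  simpa using h

theorem abs_slope_exp_le {r t : ℝ} (hr : 0 ≤ r) (ht : 0 < t) :
    |t⁻¹ * (Real.exp (-(r * t)) - 1)| ≤ r := by
  have h1 : Real.exp (-(r * t)) ≤ 1 := Real.exp_le_one_iff.2 (by nlinarith)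
  have h2 := Real.one_sub_le_exp_neg (r * t)
  rw [abs_mul, abs_of_pos (inv_pos.2 ht), abs_of_nonpos (by linarith), inv_mul_le_iff₀ ht]
  linarith

section Semigroup

variable {b : HilbertBasis ι ℂ H} {lam : ι → ℝ} {T : ℝ → H →L[ℂ] H}

/-- `T` acts for `t ≥ 0` diagonally in the basis `b`, with the eigenvalues `exp (-λ t)`. -/
def IsDiagonalSemigroup (b : HilbertBasis ι ℂ H) (lam : ι → ℝ) (T : ℝ → H →L[ℂ] H) : Prop :=
  ∀ t, 0 ≤ t → ∀ i f, ⟪b i, T t f⟫_ℂ = (Real.exp (-(lam i * t)) : ℂ) * ⟪b i, f⟫_ℂ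

theorem exists_isDiagonalSemigroup (b : HilbertBasis ι ℂ H) (hlam : ∀ i, 0 ≤ lam i) :
    ∃ T : ℝ → H →L[ℂ] H, IsDiagonalSemigroup b lam T := by
  have : ∀ t : ℝ, ∃ S : H →L[ℂ] H, 0 ≤ t →
      ∀ i f, ⟪b i, S f⟫_ℂ = (Real.exp (-(lam i * t)) : ℂ) * ⟪b i, f⟫_ℂ := by
    intro t
    by_cases ht : 0 ≤ t
    · obtain ⟨S, hS⟩ := exists_diagonal b (fun i => (Real.exp (-(lam i * t)) : ℂ)) (fun i => by
        rw [Complex.norm_real, Real.norm_eq_abs, abs_of_pos (Real.exp_pos _), Real.exp_le_one_iff]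
        have := mul_nonneg (hlam i) ht
        linarith)
      exact ⟨S, fun _ => hS⟩
    · exact ⟨0, fun h => absurd h ht⟩
  choose T hT using this
  exact ⟨T, hT⟩

theorem IsDiagonalSemigroup.isC₀Semigroup (hT : IsDiagonalSemigroup b lam T)
    (hlam : ∀ i, 0 ≤ lam i) : IsC₀Semigroup T where
  zero := by
    ext f
    exact ext_coeff b fun i => by rw [hT 0 le_rfl]; simp
  add s t hs ht := by
    ext f
    refine ext_coeff b fun i => ?_
    rw [mul_apply_eq_comp, hT _ (add_nonneg hs ht), hT _ hs, hT _ ht, ← mul_assoc,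
      ← Complex.ofReal_mul, ← Real.exp_add]
    ring_nf
  tendsto f := by
    refine tendsto_of_coeff b (hasSum_norm_sq_coeff b f).summable ?_ fun i => ?_
    · filter_upwards [self_mem_nhdsWithin] with t (ht : 0 < t) i
      rw [inner_sub_right, hT t ht.le, ← sub_one_mul, norm_mul]
      gcongr
      refine mul_le_of_le_one_left (norm_nonneg _) ?_
      have h1 : Real.exp (-(lam i * t)) ≤ 1 := Real.exp_le_one_iff.2 (by
        have := mul_nonneg (hlam i) ht.le
        linarith)
      have h0 := Real.exp_pos (-(lam i * t))
      rw [← Complex.ofReal_one, ← Complex.ofReal_sub, Complex.norm_real, Real.norm_eq_abs,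
        abs_le]
      constructor <;> linarith
    · have h1 : Tendsto (fun t : ℝ => (Real.exp (-(lam i * t)) : ℂ) * ⟪b i, f⟫_ℂ) (𝓝[>] 0)
          (𝓝 ((Real.exp (-(lam i * 0)) : ℂ) * ⟪b i, f⟫_ℂ)) := by
        refine Tendsto.mono_left (Continuous.tendsto ?_ _) nhdsWithin_le_nhds
        fun_prop
      simp only [mul_zero, neg_zero, Real.exp_zero, Complex.ofReal_one, one_mul] at h1
      refine h1.congr' ?_
      filter_upwards [self_mem_nhdsWithin] with t (ht : 0 < t)
      rw [hT t ht.le]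

theorem IsDiagonalSemigroup.coeff_slope (hT : IsDiagonalSemigroup b lam T) {t : ℝ} (ht : 0 < t)
    (i : ι) (f : H) : ⟪b i, ((t⁻¹ : ℝ) : ℂ) • (T t f - f)⟫_ℂ =
      ((t⁻¹ * (Real.exp (-(lam i * t)) - 1) : ℝ) : ℂ) * ⟪b i, f⟫_ℂ := by
  rw [inner_smul_right, inner_sub_right, hT t ht.le]
  push_cast
  ring

/-- Necessity is the derivative of `exp (-λ t)` at `0` in each coefficient. For sufficiency, the
difference quotients are at most `λ` in modulus, so the coefficients of `g` themselves dominate the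
error. -/
theorem IsDiagonalSemigroup.isGeneratorValue_iff (hT : IsDiagonalSemigroup b lam T)
    (hlam : ∀ i, 0 ≤ lam i) (f g : H) :
    IsGeneratorValue T f g ↔ ∀ i, ⟪b i, g⟫_ℂ = -(lam i : ℂ) * ⟪b i, f⟫_ℂ := by
  have hlim : ∀ i, Tendsto (fun t : ℝ => ⟪b i, ((t⁻¹ : ℝ) : ℂ) • (T t f - f)⟫_ℂ) (𝓝[>] 0)
      (𝓝 (-(lam i : ℂ) * ⟪b i, f⟫_ℂ)) := by
    intro i
    have h1 := ((Complex.continuous_ofReal.tendsto _).comp (tendsto_slope_exp (lam i))).mul_const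
      ⟪b i, f⟫_ℂ
    rw [Complex.ofReal_neg] at h1
    refine h1.congr' ?_
    filter_upwards [self_mem_nhdsWithin] with t (ht : 0 < t)
    rw [hT.coeff_slope ht]
    rfl
  constructor
  · intro h i
    exact tendsto_nhds_unique (((innerSL ℂ (b i)).continuous.tendsto g).comp h) (hlim i)
  · intro h
    -- The quotient and its limit `-λ` are each at most `λ` in modulus, so their squared distance is
    -- at most `4 λ²`.
    refine tendsto_of_coeff b ((hasSum_norm_sq_coeff b g).summable.mul_left 4) ?_ fun i => ?_
    · filter_upwards [self_mem_nhdsWithin] with t (ht : 0 < t) i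
      rw [inner_sub_right, hT.coeff_slope ht, h i, neg_mul, sub_neg_eq_add, ← add_mul, norm_mul,
        norm_neg, norm_mul, mul_pow, mul_pow, ← mul_assoc]
      gcongr
      have h1 := abs_slope_exp_le (hlam i) ht
      rw [← Complex.ofReal_add, Complex.norm_real, Complex.norm_real, Real.norm_eq_abs,
        Real.norm_eq_abs, sq_abs, sq_abs]
      have := abs_le.1 h1
      nlinarith [hlam i]
    · rw [h i]
      exact hlim i

end Semigroup

/-! ### Trace class. -/

section Trace

universe u

variable {E : Type u} [NormedAddCommGroup E] [InnerProductSpace ℂ E] [CompleteSpace E]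

/-- Nonnegative eigenvalues make `S` positive, so `|S| = S`. In any other basis `e` the trace is the
double sum of `a i * |⟨b i, e k⟩|²`; its terms are nonnegative, and summing over `k` first leaves `∑
a i` because `‖b i‖ = 1`. -/
theorem isTraceClass_of_diagonal (b : HilbertBasis ι ℂ E) (a : ι → ℝ) (ha : ∀ i, 0 ≤ a i)
    (hsum : Summable a) (S : E →L[ℂ] E) (hS : ∀ i f, ⟪b i, S f⟫_ℂ = (a i : ℂ) * ⟪b i, f⟫_ℂ) :
    IsTraceClass S := by
  have hform : ∀ f g, HasSum (fun i => (a i : ℂ) * (⟪f, b i⟫_ℂ * ⟪b i, g⟫_ℂ)) ⟪f, S g⟫_ℂ := by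
    intro f g
    convert! b.hasSum_inner_mul_inner f (S g) using 2 with i
    rw [hS]
    ring
  have hquad : ∀ f, HasSum (fun i => a i * ‖⟪b i, f⟫_ℂ‖ ^ 2) (⟪f, S f⟫_ℂ).re ∧
      ⟪f, S f⟫_ℂ = ((⟪f, S f⟫_ℂ).re : ℂ) := by
    intro f
    have h1 : HasSum (fun i => ((a i * ‖⟪b i, f⟫_ℂ‖ ^ 2 : ℝ) : ℂ)) ⟪f, S f⟫_ℂ := by
      convert! hform f f using 2 with i
      rw [← inner_conj_symm f (b i), ← Complex.normSq_eq_conj_mul_self,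
        Complex.normSq_eq_norm_sq]
      push_cast
      ring
    have h2 : HasSum (fun i => a i * ‖⟪b i, f⟫_ℂ‖ ^ 2) (⟪f, S f⟫_ℂ).re := by
      simpa only [Complex.reCLM_apply, Complex.ofReal_re] using h1.mapL Complex.reCLM
    exact ⟨h2, h1.unique (by exact_mod_cast h2)⟩
  have hpos : 0 ≤ S := by
    rw [ContinuousLinearMap.nonneg_iff_isPositive]
    rw [ContinuousLinearMap.isPositive_def']
    refine ⟨?_, fun f => ?_⟩
    · rw [ContinuousLinearMap.isSelfAdjoint_iff_isSymmetric]
      intro f g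
      change ⟪S f, g⟫_ℂ = ⟪f, S g⟫_ℂ
      rw [← inner_conj_symm]
      refine HasSum.unique ?_ (hform f g)
      convert! (hform g f).map (starRingEnd ℂ) Complex.continuous_conj using 2 with i
      simp only [Function.comp_apply, map_mul, Complex.conj_ofReal, inner_conj_symm]
      ring
    · rw [ContinuousLinearMap.reApplyInnerSelf_apply, ← inner_conj_symm]
      simp only [RCLike.re_to_complex, Complex.conj_re]
      exact (hquad f).1.nonneg fun i => mul_nonneg (ha i) (by positivity)
  intro κ e
  rw [CFC.abs_of_nonneg S hpos]
  have hprod : Summable fun p : ι × κ => a p.1 * ‖⟪b p.1, e p.2⟫_ℂ‖ ^ 2 := by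
    have hfib : ∀ i, HasSum (fun k => a i * ‖⟪b i, e k⟫_ℂ‖ ^ 2) (a i) := by
      intro i
      have := (hasSum_norm_sq_coeff e (b i)).mul_left (a i)
      rw [b.orthonormal.norm_eq_one i, one_pow, mul_one] at this
      simpa only [norm_inner_symm (b i)] using this
    rw [summable_prod_of_nonneg fun p => mul_nonneg (ha _) (by positivity)]
    exact ⟨fun i => (hfib i).summable, by simpa only [(hfib _).tsum_eq] using hsum⟩
  have h2 : Summable fun k => (⟪e k, S (e k)⟫_ℂ).re := by
    have := ((Equiv.prodComm κ ι).summable_iff.2 hprod).prod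
    simpa only [Function.comp_def, Equiv.prodComm_apply, Prod.fst_swap, Prod.snd_swap,
      (hquad _).1.tsum_eq] using this
  convert! Complex.ofRealCLM.summable h2 using 2 with k
  exact (hquad _).2

theorem IsDiagonalSemigroup.isTraceClass {b : HilbertBasis ι ℂ E} {lam : ι → ℝ}
    {T : ℝ → E →L[ℂ] E} (hT : IsDiagonalSemigroup b lam T) {t : ℝ} (ht : 0 ≤ t)
    (hsum : Summable fun i => Real.exp (-(lam i * t))) : IsTraceClass (T t) :=
  isTraceClass_of_diagonal b _ (fun _ => (Real.exp_pos _).le) hsum _ (hT t ht)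

end Trace

/-- The vectors need not be normalised and may vanish, so the orthogonal family consists of the
lines they span. This serves the differentiated Hermite series. -/
theorem summable_of_pairwise_orthogonal [CompleteSpace H] {v : ι → H}
    (hv : Pairwise fun i j => ⟪v i, v j⟫_ℂ = 0) (hs : Summable fun i => ‖v i‖ ^ 2) :
    Summable v := by
  have hV : OrthogonalFamily ℂ (fun i => ↥(ℂ ∙ v i)) fun i => (ℂ ∙ v i).subtypeₗᵢ := by
    refine OrthogonalFamily.of_pairwise fun i j hij => ?_
    refine Submodule.isOrtho_span.2 ?_
    simp only [Set.mem_singleton_iff]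
    rintro _ rfl _ rfl
    exact hv hij
  have := (hV.summable_iff_norm_sq_summable
    (fun i => ⟨v i, Submodule.mem_span_singleton_self _⟩)).2 (by simpa using hs)
  simpa using this

end Diagonal

/-! ### The weighted `L²` space of one ray. -/

open Polynomial

/-- The density of the ray measure. -/
def rayDensity (m : ℕ) (x : ℝ) : ℝ := 2 / (m * √Real.pi) * Real.exp (-x ^ 2)

theorem rayDensity_pos {m : ℕ} (hm : 0 < m) (x : ℝ) : 0 < rayDensity m x := by
  have : (0 : ℝ) < m := Nat.cast_pos.2 hm
  have := Real.pi_pos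
  unfold rayDensity
  positivity

theorem rayDensity_nonneg (m : ℕ) (x : ℝ) : 0 ≤ rayDensity m x := by
  unfold rayDensity
  positivity

theorem continuous_rayDensity (m : ℕ) : Continuous (rayDensity m) := by
  unfold rayDensity
  fun_prop

theorem rayMeasure_eq (m : ℕ) : rayMeasure m =
    (volume.restrict (Set.Ioi (0 : ℝ))).withDensity (fun x => ENNReal.ofReal (rayDensity m x)) :=
  rfl

/-- The density is positive everywhere, which needs `0 < m`: for `m = 0` it is the zero function. -/
theorem ae_rayMeasure {m : ℕ} (hm : 0 < m) :
    ae (rayMeasure m) = ae (volume.restrict (Set.Ioi (0 : ℝ))) := by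
  rw [rayMeasure_eq]
  apply le_antisymm
  · exact (withDensity_absolutelyContinuous _ _).ae_le
  · refine (withDensity_absolutelyContinuous' ?_ ?_).ae_le
    · exact (continuous_rayDensity m).measurable.ennreal_ofReal.aemeasurable
    · exact .of_forall fun x => (ENNReal.ofReal_pos.2 (rayDensity_pos hm x)).ne'

theorem integrable_rayMeasure_iff (m : ℕ) {E : Type*} [NormedAddCommGroup E] [NormedSpace ℝ E]
    (F : ℝ → E) : Integrable F (rayMeasure m) ↔
      IntegrableOn (fun x => rayDensity m x • F x) (Set.Ioi 0) := by
  rw [rayMeasure_eq, integrable_withDensity_iff_integrable_smul'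
    (continuous_rayDensity m).measurable.ennreal_ofReal (by simp)]
  simp only [ENNReal.toReal_ofReal (rayDensity_nonneg m _)]
  rfl

theorem integral_rayMeasure (m : ℕ) (F : ℝ → ℂ) :
    ∫ x, F x ∂(rayMeasure m) = ∫ x in Set.Ioi (0 : ℝ), (rayDensity m x : ℂ) * F x := by
  rw [rayMeasure_eq, integral_withDensity_eq_integral_toReal_smul
    (continuous_rayDensity m).measurable.ennreal_ofReal (by simp)]
  simp only [ENNReal.toReal_ofReal (rayDensity_nonneg m _), Complex.real_smul]

theorem memLp_two_rayMeasure_iff (m : ℕ) {F : ℝ → ℂ}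
    (hF : AEStronglyMeasurable F (volume.restrict (Set.Ioi (0 : ℝ)))) :
    MemLp F 2 (rayMeasure m) ↔
      IntegrableOn (fun x => rayDensity m x * ‖F x‖ ^ 2) (Set.Ioi 0) := by
  have hF' : AEStronglyMeasurable F (rayMeasure m) :=
    hF.mono_ac (withDensity_absolutelyContinuous _ _)
  rw [memLp_two_iff_integrable_sq_norm hF', integrable_rayMeasure_iff]
  rfl

theorem inner_eq_integral {m : ℕ} (f g : RayL2 m) :
    ⟪f, g⟫_ℂ = ∫ x in Set.Ioi (0 : ℝ), (rayDensity m x : ℂ) * (starRingEnd ℂ (f x) * g x) := by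
  rw [L2.inner_def, integral_rayMeasure]
  simp only [RCLike.inner_apply']

theorem integrableOn_density_mul {m : ℕ} (f g : RayL2 m) :
    IntegrableOn (fun x => (rayDensity m x : ℂ) * (starRingEnd ℂ (f x) * g x)) (Set.Ioi 0) := by
  have h := L2.integrable_inner (𝕜 := ℂ) f g
  rw [integrable_rayMeasure_iff] at h
  simpa only [RCLike.inner_apply', Complex.real_smul] using h

/-- Testing against a weight `φ` with `∫ φ² exp (x²) < ∞` is a bounded functional. -/
theorem exists_functional {m : ℕ} (hm : 0 < m) {φ : ℝ → ℝ} (hφ : Measurable φ)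
    (hint : IntegrableOn (fun x => φ x ^ 2 * Real.exp (x ^ 2)) (Set.Ioi 0)) :
    ∃ L : RayL2 m →L[ℂ] ℂ, ∀ f : RayL2 m,
      IntegrableOn (fun x => (φ x : ℂ) * f x) (Set.Ioi 0) ∧
      L f = ∫ x in Set.Ioi (0 : ℝ), (φ x : ℂ) * f x := by
  -- The Riesz representative is `φ` divided by the density; as the density is a multiple of `exp
  -- (-x²)`, its squared norm is a multiple of the integral in `hint`.
  have hmem : MemLp (fun x => ((φ x / rayDensity m x : ℝ) : ℂ)) 2 (rayMeasure m) := by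
    rw [memLp_two_rayMeasure_iff]
    · refine IntegrableOn.congr_fun (hint.const_mul (m * √Real.pi / 2)) (fun x _ => ?_)
        measurableSet_Ioi
      have h0 : (0 : ℝ) < m := Nat.cast_pos.2 hm
      have h1 := Real.pi_pos
      have h2 : 0 < √Real.pi := Real.sqrt_pos.2 h1
      simp only [Complex.norm_real, Real.norm_eq_abs, sq_abs]
      rw [div_pow, sq (rayDensity m x), ← mul_div_assoc, mul_div_mul_left _ _
        (rayDensity_pos hm x).ne', rayDensity, Real.exp_neg]
      have := Real.exp_pos (x ^ 2)
      field_simp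
    · exact (Complex.measurable_ofReal.comp
        (hφ.div (continuous_rayDensity m).measurable)).aestronglyMeasurable
  have hae := hmem.coeFn_toLp
  rw [EventuallyEq, ae_rayMeasure hm] at hae
  have key : ∀ f : RayL2 m, (fun x => (rayDensity m x : ℂ) *
      (starRingEnd ℂ (hmem.toLp _ x) * f x)) =ᵐ[volume.restrict (Set.Ioi 0)]
      fun x => (φ x : ℂ) * f x := by
    intro f
    filter_upwards [hae] with x hx
    rw [hx, Complex.conj_ofReal, ← mul_assoc, ← Complex.ofReal_mul,
      mul_div_cancel₀ _ (rayDensity_pos hm x).ne']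
  refine ⟨innerSL ℂ (hmem.toLp _), fun f => ⟨?_, ?_⟩⟩
  · exact (integrableOn_density_mul (hmem.toLp _) f).congr (key f)
  · rw [innerSL_apply_apply, inner_eq_integral]
    exact integral_congr_ae (key f)

theorem integrable_eval_mul_gaussian {s : ℝ} (hs : 0 < s) (c : ℝ) (p : ℝ[X]) :
    Integrable fun y => p.eval y * Real.exp (-s * (c - y) ^ 2) := by
  have h0 : ∀ q : ℝ[X], Integrable fun y => q.eval y * Real.exp (-s * y ^ 2) := by
    intro q
    induction q using Polynomial.induction_on' with
    | add p q hp hq =>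
      refine (hp.add hq).congr (.of_forall fun y => ?_)
      simp [add_mul]
    | monomial n a =>
      have := (integrable_rpow_mul_exp_neg_mul_sq hs (s := n)
        (by have : (0 : ℝ) ≤ n := n.cast_nonneg
            linarith)).const_mul a
      simpa [mul_assoc] using this
  have h1 := (h0 (p.comp (X + C c))).comp_sub_right c
  refine h1.congr (.of_forall fun y => ?_)
  simp only [eval_comp, eval_add, eval_X, eval_C, sub_add_cancel]
  congr 3
  ring

theorem memLp_eval (m : ℕ) (p : ℝ[X]) :
    MemLp (fun x => ((p.eval x : ℝ) : ℂ)) 2 (rayMeasure m) := by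
  rw [memLp_two_rayMeasure_iff]
  · have h := ((integrable_eval_mul_gaussian one_pos 0 (p ^ 2)).const_mul
      (2 / (m * √Real.pi))).integrableOn (s := Set.Ioi 0)
    refine h.congr_fun (fun x _ => ?_) measurableSet_Ioi
    simp only [Complex.norm_real, Real.norm_eq_abs, sq_abs, rayDensity, eval_pow, zero_sub,
      neg_sq, neg_mul, one_mul]
    ring
  · exact (Complex.continuous_ofReal.comp p.continuous).aestronglyMeasurable

/-- A real polynomial as an element of the `L²` space of a ray. -/
def polyL (m : ℕ) (p : ℝ[X]) : RayL2 m := (memLp_eval m p).toLp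

theorem coeFn_polyL {m : ℕ} (hm : 0 < m) (p : ℝ[X]) :
    polyL m p =ᵐ[volume.restrict (Set.Ioi 0)] fun x => ((p.eval x : ℝ) : ℂ) := by
  have := (memLp_eval m p).coeFn_toLp
  rwa [EventuallyEq, ae_rayMeasure hm] at this

theorem polyL_add (m : ℕ) (p q : ℝ[X]) : polyL m (p + q) = polyL m p + polyL m q := by
  rw [polyL, polyL, polyL, ← MemLp.toLp_add]
  congr 1
  funext x
  simp

theorem polyL_smul (m : ℕ) (c : ℝ) (p : ℝ[X]) : polyL m (c • p) = (c : ℂ) • polyL m p := by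
  rw [polyL, polyL, ← MemLp.toLp_const_smul]
  congr 1
  funext x
  simp

theorem inner_polyL {m : ℕ} (hm : 0 < m) (p : ℝ[X]) (f : RayL2 m) :
    ⟪polyL m p, f⟫_ℂ = ∫ x in Set.Ioi (0 : ℝ), ((rayDensity m x * p.eval x : ℝ) : ℂ) * f x := by
  rw [inner_eq_integral]
  refine integral_congr_ae ?_
  filter_upwards [coeFn_polyL hm p] with x hx
  rw [hx, Complex.conj_ofReal]
  push_cast
  ring

theorem integrableOn_polyL_mul {m : ℕ} (hm : 0 < m) (p : ℝ[X]) (f : RayL2 m) :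
    IntegrableOn (fun x => ((rayDensity m x * p.eval x : ℝ) : ℂ) * f x) (Set.Ioi 0) := by
  refine (integrableOn_density_mul (polyL m p) f).congr ?_
  filter_upwards [coeFn_polyL hm p] with x hx
  rw [hx, Complex.conj_ofReal]
  push_cast
  ring

theorem exists_subseq_tendsto_ae {m : ℕ} (hm : 0 < m) {F : ℕ → RayL2 m} {f : RayL2 m}
    (h : Tendsto F atTop (𝓝 f)) : ∃ ns : ℕ → ℕ, StrictMono ns ∧
      ∀ᵐ x ∂(volume.restrict (Set.Ioi (0 : ℝ))),
        Tendsto (fun n => F (ns n) x) atTop (𝓝 (f x)) := by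
  have := (tendstoInMeasure_of_tendsto_Lp h).exists_seq_tendsto_ae
  rwa [ae_rayMeasure hm] at this

/-! ### Primitives, boundary values and weak derivatives on a ray. -/

theorem integrableOn_indicator_exp (R : ℝ) (w : ℝ → ℝ) (hw : Continuous w) :
    IntegrableOn (fun x => (Set.Iic R).indicator w x ^ 2 * Real.exp (x ^ 2)) (Set.Ioi 0) := by
  have h1 : IntegrableOn (fun x => w x ^ 2 * Real.exp (x ^ 2)) (Set.Ioc 0 R) :=
    (Continuous.continuousOn (by fun_prop)).integrableOn_Icc.mono_set Set.Ioc_subset_Icc_self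
  have h2 : IntegrableOn ((Set.Iic R).indicator fun x => w x ^ 2 * Real.exp (x ^ 2))
      (Set.Ioi 0) := by
    rw [IntegrableOn, integrable_indicator_iff measurableSet_Iic, IntegrableOn,
      Measure.restrict_restrict measurableSet_Iic, Set.inter_comm, Set.Ioi_inter_Iic]
    exact h1
  refine h2.congr_fun (fun x _ => ?_) measurableSet_Ioi
  by_cases hx : x ∈ Set.Iic R <;> simp [hx]

theorem setIntegral_indicator_Iic {R : ℝ} (hR : 0 ≤ R) (w : ℝ → ℝ) (f : ℝ → ℂ) :
    ∫ x in Set.Ioi (0 : ℝ), (((Set.Iic R).indicator w x : ℝ) : ℂ) * f x =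
      ∫ x in (0 : ℝ)..R, (w x : ℂ) * f x := by
  rw [intervalIntegral.integral_of_le hR, ← Set.Ioi_inter_Iic, Set.inter_comm,
    ← Measure.restrict_restrict measurableSet_Iic, ← integral_indicator measurableSet_Iic]
  congr 1
  funext x
  by_cases hx : x ∈ Set.Iic R <;> simp [hx]

/-- Integration over a bounded interval against a continuous weight is a bounded functional. -/
theorem exists_intervalFunctional {m : ℕ} (hm : 0 < m) {R : ℝ} (hR : 0 ≤ R) {w : ℝ → ℝ}
    (hw : Continuous w) :
    ∃ L : RayL2 m →L[ℂ] ℂ, ∀ f : RayL2 m, L f = ∫ x in (0 : ℝ)..R, (w x : ℂ) * f x := by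
  obtain ⟨L, hL⟩ := exists_functional hm (hw.measurable.indicator measurableSet_Iic)
    (integrableOn_indicator_exp R w hw)
  exact ⟨L, fun f => by rw [(hL f).2, setIntegral_indicator_Iic hR]⟩

theorem intervalIntegrable_rayL2 {m : ℕ} (hm : 0 < m) {R : ℝ} (hR : 0 ≤ R) (f : RayL2 m) :
    IntervalIntegrable f volume 0 R := by
  obtain ⟨L, hL⟩ := exists_functional hm ((measurable_const (a := (1 : ℝ))).indicator
    measurableSet_Iic) (integrableOn_indicator_exp R _ continuous_const)
  rw [intervalIntegrable_iff_integrableOn_Ioc_of_le hR]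
  refine ((hL f).1.mono_set Set.Ioc_subset_Ioi_self).congr_fun (fun x hx => ?_) measurableSet_Ioc
  have : x ∈ Set.Iic R := hx.2
  simp [this]

/-- `u(x) = c + ∫₀ˣ v` for almost every `x > 0`. -/
def IsPrimitive (u v : ℝ → ℂ) (c : ℂ) : Prop :=
  u =ᵐ[volume.restrict (Set.Ioi 0)] fun x => c + ∫ y in (0 : ℝ)..x, v y

/-- Increments of the primitive of `v` are bounded by those of the primitive of `‖v‖`, which reduces
the complex case to a real one. -/
theorem absolutelyContinuousOnInterval_primitive {v : ℝ → ℂ} {R : ℝ}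
    (hv : IntervalIntegrable v volume 0 R) :
    AbsolutelyContinuousOnInterval (fun x => ∫ y in (0 : ℝ)..x, v y) 0 R := by
  have hn := hv.norm.absolutelyContinuousOnInterval_intervalIntegral (c := 0) Set.left_mem_uIcc
  have hsub : ∀ {w : ℝ → ℂ} {x : ℝ}, IntervalIntegrable w volume 0 R → x ∈ Set.uIcc 0 R →
      IntervalIntegrable w volume 0 x := fun hw hx =>
    hw.mono_set (Set.uIcc_subset_uIcc Set.left_mem_uIcc hx)
  rw [absolutelyContinuousOnInterval_iff] at hn ⊢
  intro ε hε
  obtain ⟨δ, hδ, h⟩ := hn ε hε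
  refine ⟨δ, hδ, fun E hE hlt => lt_of_le_of_lt (Finset.sum_le_sum fun i hi => ?_) (h E hE hlt)⟩
  obtain ⟨h1, h2⟩ := hE.1 i hi
  rw [dist_eq_norm, Real.dist_eq, intervalIntegral.integral_interval_sub_left (hsub hv h1)
    (hsub hv h2), intervalIntegral.integral_interval_sub_left (hsub hv h1).norm (hsub hv h2).norm]
  exact intervalIntegral.norm_integral_le_abs_integral_norm

/-- The product of `φ` and the primitive, minus the integral of its formal derivative, is absolutely
continuous with derivative zero almost everywhere, hence constant. -/
theorem integral_by_parts_primitive {v : ℝ → ℂ} {R : ℝ}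
    (hv : IntervalIntegrable v volume 0 R) (c : ℂ) {φ : ℝ → ℝ} (hφ : ContDiff ℝ 1 φ) :
    ∫ x in (0 : ℝ)..R, ((φ x : ℂ) * v x + ((deriv φ x : ℝ) : ℂ) * (c + ∫ y in (0 : ℝ)..x, v y)) =
      φ R * (c + ∫ y in (0 : ℝ)..R, v y) - φ 0 * c := by
  have hU : AbsolutelyContinuousOnInterval (fun x => c + ∫ y in (0 : ℝ)..x, v y) 0 R := by
    have h2 : AbsolutelyContinuousOnInterval (fun _ : ℝ => c) 0 R :=
      contDiff_const.contDiffOn.absolutelyContinuousOnInterval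
    exact h2.add (absolutelyContinuousOnInterval_primitive hv)
  have hφc : Continuous φ := hφ.continuous
  have hφ' : Continuous (deriv φ) := hφ.continuous_deriv le_rfl
  have hprod : AbsolutelyContinuousOnInterval
      (fun x => φ x • (c + ∫ y in (0 : ℝ)..x, v y)) 0 R :=
    hφ.contDiffOn.absolutelyContinuousOnInterval.smul hU
  have hint : IntervalIntegrable (fun x => (φ x : ℂ) * v x +
      ((deriv φ x : ℝ) : ℂ) * (c + ∫ y in (0 : ℝ)..x, v y)) volume 0 R := by
    refine (hv.continuousOn_mul ?_).add (ContinuousOn.intervalIntegrable ?_)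
    · exact (Complex.continuous_ofReal.comp hφc).continuousOn
    · exact (Complex.continuous_ofReal.comp hφ').continuousOn.mul hU.continuousOn
  have hI := absolutelyContinuousOnInterval_primitive hint
  obtain ⟨C, hC⟩ := (hprod.sub hI).const_of_ae_hasDerivAt_zero (by
    filter_upwards [hv.ae_hasDerivAt_integral, hint.ae_hasDerivAt_integral] with x h1 h2 hx
    have d1 := (hφ.differentiable one_ne_zero x).hasDerivAt.smul
      ((h1 hx 0 (by simp)).const_add c)
    refine (d1.sub (h2 hx 0 (by simp))).congr_deriv ?_
    simp only [Complex.real_smul]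
    ring)
  have h0 := hC 0 (by simp)
  have hR := hC R (by simp)
  simp only [Pi.sub_apply, intervalIntegral.integral_same, Complex.real_smul, add_zero,
    sub_zero] at h0 hR
  rw [h0, ← hR]
  ring

theorem continuousOn_primitive {m : ℕ} (hm : 0 < m) (v : RayL2 m) (c : ℂ) :
    ContinuousOn (fun x => c + ∫ y in (0 : ℝ)..x, v y) (Set.Ici 0) := by
  refine continuousOn_const.add fun x hx => ?_
  have hx' : (0 : ℝ) ≤ x := hx
  have h := (absolutelyContinuousOnInterval_primitive
    (intervalIntegrable_rayL2 hm (by linarith : (0 : ℝ) ≤ x + 1) v)).continuousOn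
  rw [Set.uIcc_of_le (by linarith)] at h
  refine (h x ⟨hx', by linarith⟩).mono_of_mem_nhdsWithin ?_
  rw [← Set.Ici_inter_Iic]
  exact inter_mem_nhdsWithin _ (Iic_mem_nhds (by linarith))

theorem IsPrimitive.hasValueAtZero {m : ℕ} (hm : 0 < m) {u v : RayL2 m} {c : ℂ}
    (h : IsPrimitive u v c) : HasValueAtZero u c :=
  ⟨_, continuousOn_primitive hm v c, h.symm, by simp⟩

/-- Functions continuous on `[0, ∞)` that agree almost everywhere agree at every point, the endpoint
included; so the boundary value does not depend on the representative. -/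
theorem IsPrimitive.eq_of_hasValueAtZero {m : ℕ} (hm : 0 < m) {u v : RayL2 m} {c d : ℂ}
    (h : IsPrimitive u v c) (hd : HasValueAtZero u d) : c = d := by
  obtain ⟨F, hF, hFu, rfl⟩ := hd
  have hae : F =ᵐ[volume.restrict (Set.Ici 0)] fun x => c + ∫ y in (0 : ℝ)..x, v y := by
    rw [Measure.restrict_congr_set Ioi_ae_eq_Ici.symm]
    exact hFu.trans h
  have := Measure.eqOn_of_ae_eq hae hF (continuousOn_primitive hm v c) (by simp)
    (Set.mem_Ici.2 (le_refl (0 : ℝ)))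
  simpa using this.symm

theorem isPrimitive_mul_deriv {m : ℕ} (hm : 0 < m) (v : RayL2 m) (c : ℂ) {φ : ℝ → ℝ}
    (hφ : ContDiff ℝ ∞ φ) (hc : HasCompactSupport φ) (hs : tsupport φ ⊆ Set.Ioi 0) :
    IntegrableOn (fun x => (c + ∫ y in (0 : ℝ)..x, v y) * ((deriv φ x : ℝ) : ℂ)) (Set.Ioi 0) ∧
    ∫ x in Set.Ioi (0 : ℝ), (c + ∫ y in (0 : ℝ)..x, v y) * ((deriv φ x : ℝ) : ℂ) =
      -∫ x in Set.Ioi (0 : ℝ), v x * (φ x : ℂ) := by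
  obtain ⟨R, hR0, hR⟩ : ∃ R : ℝ, 0 ≤ R ∧ ∀ x, R ≤ x → x ∉ tsupport φ := by
    obtain ⟨B, hB⟩ := hc.bddAbove
    refine ⟨max 0 (B + 1), le_max_left _ _, fun x hx hx' => ?_⟩
    have := hB hx'
    have := le_max_right 0 (B + 1)
    linarith
  have hφ1 : ContDiff ℝ 1 φ := hφ.of_le (by simp)
  have hz : ∀ x, R ≤ x → φ x = 0 := fun x hx => image_eq_zero_of_notMem_tsupport (hR x hx)
  have hz' : ∀ x, R ≤ x → deriv φ x = 0 := fun x hx =>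
    image_eq_zero_of_notMem_tsupport fun h => hR x hx (tsupport_deriv_subset h)
  have h0 : φ 0 = 0 := image_eq_zero_of_notMem_tsupport fun h => lt_irrefl (0 : ℝ) (hs h)
  have hred : ∀ G : ℝ → ℂ, (∀ x, R ≤ x → G x = 0) →
      ∫ x in Set.Ioi (0 : ℝ), G x = ∫ x in (0 : ℝ)..R, G x := by
    intro G hG
    rw [intervalIntegral.integral_of_le hR0]
    refine setIntegral_eq_of_subset_of_forall_sdiff_eq_zero measurableSet_Ioi
      Set.Ioc_subset_Ioi_self fun x hx => hG x ?_
    by_contra hlt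
    exact hx.2 ⟨hx.1, (not_le.1 hlt).le⟩
  have hv := intervalIntegrable_rayL2 hm hR0 v
  have hUc : ContinuousOn (fun x => (c + ∫ y in (0 : ℝ)..x, v y) * ((deriv φ x : ℝ) : ℂ))
      (Set.Icc 0 R) :=
    ((continuousOn_primitive hm v c).mono Set.Icc_subset_Ici_self).mul
      (Complex.continuous_ofReal.comp (hφ1.continuous_deriv le_rfl)).continuousOn
  refine ⟨?_, ?_⟩
  · refine (hUc.integrableOn_Icc).of_forall_sdiff_eq_zero measurableSet_Ioi fun x hx => ?_
    rw [hz' x ?_]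
    · simp
    · by_contra hlt
      exact hx.2 ⟨le_of_lt hx.1, (not_le.1 hlt).le⟩
  · rw [hred _ fun x hx => by simp [hz' x hx], hred _ fun x hx => by simp [hz x hx],
      eq_neg_iff_add_eq_zero, ← intervalIntegral.integral_add]
    · have := integral_by_parts_primitive hv c hφ1
      rw [hz R le_rfl, h0] at this
      simp only [Complex.ofReal_zero, zero_mul, sub_zero] at this
      rw [← this]
      congr 1
      funext x
      ring
    · refine ContinuousOn.intervalIntegrable ?_
      rwa [Set.uIcc_of_le hR0]
    · exact hv.mul_continuousOn (Complex.continuous_ofReal.comp hφ.continuous).continuousOn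

theorem IsPrimitive.isWeakDeriv {m : ℕ} (hm : 0 < m) {u v : RayL2 m} {c : ℂ}
    (h : IsPrimitive u v c) : IsWeakDeriv u v := by
  intro φ hφ hc hs
  rw [← (isPrimitive_mul_deriv hm v c hφ hc hs).2]
  refine integral_congr_ae ?_
  filter_upwards [h] with x hx
  rw [hx]

/-- Integrating from the left of the support gives a function that vanishes again to the right of
it, because the total integral is zero. -/
theorem exists_smooth_primitive {η : ℝ → ℝ} (hη : ContDiff ℝ ∞ η) (hc : HasCompactSupport η)
    (hs : tsupport η ⊆ Set.Ioi 0) (h0 : ∫ x, η x = 0) :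
    ∃ Φ : ℝ → ℝ, ContDiff ℝ ∞ Φ ∧ HasCompactSupport Φ ∧ tsupport Φ ⊆ Set.Ioi 0 ∧
      deriv Φ = η := by
  obtain ⟨a, b, ha, hsub⟩ : ∃ a b : ℝ, 0 < a ∧ tsupport η ⊆ Set.Ioc a b := by
    rcases (tsupport η).eq_empty_or_nonempty with he | hne
    · exact ⟨1, 1, one_pos, by simp [he]⟩
    · have hc' : IsCompact (tsupport η) := hc
      have hpos : 0 < sInf (tsupport η) := hs (hc'.sInf_mem hne)
      -- Halving the infimum keeps the left endpoint positive and strictly below the support, which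
      -- therefore fits into a half-open interval.
      refine ⟨sInf (tsupport η) / 2, sSup (tsupport η), by positivity, fun x hx => ⟨?_, ?_⟩⟩
      · have := csInf_le hc'.bddBelow hx
        linarith
      · exact le_csSup hc'.bddAbove hx
  have hη0 : ∀ x, x ∉ Set.Ioc a b → η x = 0 := fun x hx =>
    image_eq_zero_of_notMem_tsupport fun h => hx (hsub h)
  have hderiv : ∀ x, HasDerivAt (fun x => ∫ y in (a : ℝ)..x, η y) (η x) x := fun x =>
    intervalIntegral.integral_hasDerivAt_right (hη.continuous.intervalIntegrable _ _)
      (hη.continuous.stronglyMeasurableAtFilter _ _) hη.continuous.continuousAt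
  have hd : deriv (fun x => ∫ y in (a : ℝ)..x, η y) = η := funext fun x => (hderiv x).deriv
  have hsupp : tsupport (fun x => ∫ y in (a : ℝ)..x, η y) ⊆ Set.Icc a b := by
    refine closure_minimal (fun x hx => ?_) isClosed_Icc
    by_contra hx'
    apply hx
    change ∫ y in (a : ℝ)..x, η y = 0
    rcases lt_or_ge x a with hxa | hxa
    · rw [intervalIntegral.integral_symm, neg_eq_zero]
      refine intervalIntegral.integral_zero_ae (.of_forall fun y hy => hη0 y fun h => ?_)
      rw [Set.uIoc_of_le hxa.le] at hy
      exact absurd h.1 (not_lt.2 hy.2)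
    · have hb : b < x := by
        by_contra hbx
        exact hx' ⟨hxa, not_lt.1 hbx⟩
      rw [intervalIntegral.integral_eq_integral_of_support_subset, h0]
      exact fun y hy => ⟨(hsub (subset_tsupport _ hy)).1,
        (hsub (subset_tsupport _ hy)).2.trans hb.le⟩
  refine ⟨_, ?_, ?_, hsupp.trans fun x hx => lt_of_lt_of_le ha hx.1, hd⟩
  · rw [contDiff_infty_iff_deriv, hd]
    exact ⟨fun x => (hderiv x).differentiableAt, hη⟩
  · exact isCompact_Icc.of_isClosed_subset (isClosed_tsupport _) hsupp

/-- The du Bois-Reymond argument: `G = u - ∫ v` annihilates derivatives of test functions. For a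
bump `ψ` of integral one, every test function `g` minus `(∫ g) ψ` is such a derivative, so `G`
equals the constant `∫ G ψ`. -/
theorem IsWeakDeriv.exists_isPrimitive {m : ℕ} (hm : 0 < m) {u v : RayL2 m}
    (h : IsWeakDeriv u v) : ∃ c, IsPrimitive u v c := by
  set G : ℝ → ℂ := fun x => u x - (0 + ∫ y in (0 : ℝ)..x, v y) with hG
  have hu : LocallyIntegrableOn u (Set.Ioi 0) := by
    intro x hx
    refine ⟨Set.Ioc 0 (x + 1), ?_, ?_⟩
    · exact mem_nhdsWithin_of_mem_nhds (Ioc_mem_nhds hx (by linarith))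
    · have hx' : (0 : ℝ) ≤ x + 1 := by
        have : (0 : ℝ) < x := hx
        linarith
      exact (intervalIntegrable_iff_integrableOn_Ioc_of_le hx').1
        (intervalIntegrable_rayL2 hm hx' u)
  have hU : LocallyIntegrableOn (fun x => (0 : ℂ) + ∫ y in (0 : ℝ)..x, v y) (Set.Ioi 0) :=
    ((continuousOn_primitive hm v 0).mono Set.Ioi_subset_Ici_self).locallyIntegrableOn
      measurableSet_Ioi
  have hGl : LocallyIntegrableOn G (Set.Ioi 0) := hu.sub hU
  have hint : ∀ (F : ℝ → ℂ), LocallyIntegrableOn F (Set.Ioi 0) → ∀ φ : ℝ → ℝ, Continuous φ →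
      HasCompactSupport φ → tsupport φ ⊆ Set.Ioi 0 →
      IntegrableOn (fun x => F x * (φ x : ℂ)) (Set.Ioi 0) := by
    intro F hF φ hφ hc hs
    have h1 : IntegrableOn F (tsupport φ) := hF.integrableOn_compact_subset hs hc
    have h2 : IntegrableOn (fun x => F x * (φ x : ℂ)) (tsupport φ) :=
      h1.mul_continuousOn (Complex.continuous_ofReal.comp hφ).continuousOn hc
    refine h2.of_forall_sdiff_eq_zero measurableSet_Ioi fun x hx => ?_
    rw [image_eq_zero_of_notMem_tsupport hx.2]
    simp
  have hGφ : ∀ φ : ℝ → ℝ, ContDiff ℝ ∞ φ → HasCompactSupport φ → tsupport φ ⊆ Set.Ioi 0 →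
      ∫ x in Set.Ioi (0 : ℝ), G x * ((deriv φ x : ℝ) : ℂ) = 0 := by
    intro φ hφ hc hs
    obtain ⟨hi, he⟩ := isPrimitive_mul_deriv hm v 0 hφ hc hs
    have hcd : Continuous (deriv φ) := hφ.continuous_deriv (by simp)
    simp only [hG, sub_mul]
    rw [integral_sub (hint _ hu _ hcd hc.deriv (tsupport_deriv_subset.trans hs)) hi, he,
      h φ hφ hc hs, sub_self]
  -- Centre `2` and outer radius `1` put the support in `[1, 3]`, inside the open half-line.
  let ψ₀ : ContDiffBump (2 : ℝ) := ⟨1 / 2, 1, by norm_num, by norm_num⟩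
  set ψ : ℝ → ℝ := ψ₀.normed volume with hψ
  have hψd : ContDiff ℝ ∞ ψ := ψ₀.contDiff_normed
  have hψc : HasCompactSupport ψ := ψ₀.hasCompactSupport_normed
  have hψs : tsupport ψ ⊆ Set.Ioi 0 := by
    rw [hψ, ψ₀.tsupport_normed_eq]
    intro x hx
    rw [Metric.mem_closedBall, Real.dist_eq] at hx
    have h1 := (abs_le.1 hx).1
    have : ψ₀.rOut = 1 := rfl
    rw [Set.mem_Ioi]
    linarith
  have hψ1 : ∫ x, ψ x = 1 := ψ₀.integral_normed
  set c : ℂ := ∫ x in Set.Ioi (0 : ℝ), G x * (ψ x : ℂ) with hcdef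
  refine ⟨c, ?_⟩
  have key := isOpen_Ioi.ae_eq_zero_of_integral_contDiff_smul_eq_zero (U := Set.Ioi (0 : ℝ))
    (f := fun x => G x - c) (μ := volume)
    (hGl.sub (locallyIntegrableOn_const c)) (by
      intro g hg hgc hgs
      set I : ℝ := ∫ x, g x with hI
      have hsub : tsupport (fun x => g x - I * ψ x) ⊆ Set.Ioi 0 := by
        refine (tsupport_sub _ _).trans (Set.union_subset hgs ?_)
        exact tsupport_mul_subset_right.trans hψs
      have hηd : ContDiff ℝ ∞ (fun x => g x - I * ψ x) := hg.sub (contDiff_const.mul hψd)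
      have hηc : HasCompactSupport (fun x => g x - I * ψ x) := hgc.sub hψc.mul_left
      obtain ⟨Φ, h1, h2, h3, h4⟩ := exists_smooth_primitive hηd hηc hsub (by
        rw [integral_sub (hg.continuous.integrable_of_hasCompactSupport hgc)
          ((hψd.continuous.integrable_of_hasCompactSupport hψc).const_mul I),
          integral_const_mul, hψ1, mul_one, sub_self])
      have h5 := hGφ Φ h1 h2 h3
      rw [h4] at h5
      have hgi : ∫ x in Set.Ioi (0 : ℝ), (g x : ℂ) = (I : ℂ) := by
        rw [integral_complex_ofReal, hI, setIntegral_eq_integral_of_forall_compl_eq_zero]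
        exact fun x hx => image_eq_zero_of_notMem_tsupport fun h => hx (hgs h)
      have hGg := hint G hGl g hg.continuous hgc hgs
      have hGψ := hint G hGl ψ hψd.continuous hψc hψs
      have h6 : ∫ x in Set.Ioi (0 : ℝ), G x * (g x : ℂ) = I * c := by
        have : ∫ x in Set.Ioi (0 : ℝ), (G x * (g x : ℂ) - (I : ℂ) * (G x * (ψ x : ℂ))) = 0 := by
          rw [← h5]
          congr 1
          funext x
          push_cast
          ring
        rw [integral_sub hGg (hGψ.const_mul _), integral_const_mul, ← hcdef] at this
        exact sub_eq_zero.1 this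
      rw [← setIntegral_eq_integral_of_forall_compl_eq_zero (s := Set.Ioi (0 : ℝ))
        (fun x hx => by
          rw [image_eq_zero_of_notMem_tsupport fun h => hx (hgs h), zero_smul])]
      have hgI : IntegrableOn (fun x => (g x : ℂ) * c) (Set.Ioi 0) :=
        ((hg.continuous.integrable_of_hasCompactSupport hgc).ofReal.mul_const c).integrableOn
      calc ∫ x in Set.Ioi (0 : ℝ), g x • (G x - c)
          = ∫ x in Set.Ioi (0 : ℝ), (G x * (g x : ℂ) - (g x : ℂ) * c) := by
            congr 1
            funext x
            rw [Complex.real_smul]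
            ring
        _ = 0 := by
            rw [integral_sub hGg hgI, integral_mul_const, h6, hgi, sub_self])
  rw [IsPrimitive, EventuallyEq, ae_restrict_iff' measurableSet_Ioi]
  filter_upwards [key] with x hx hx0
  have := hx hx0
  simp only [hG, zero_add] at this
  linear_combination this

/-- The boundary value at `0`, as a bounded functional of a function and its derivative. -/
theorem exists_boundaryFunctional {m : ℕ} (hm : 0 < m) :
    ∃ L : RayL2 m × RayL2 m →L[ℂ] ℂ, ∀ (u v : RayL2 m) (c : ℂ), IsPrimitive u v c → L (u, v) = c := by
  -- Averaging `u = c + ∫ v` over `[0, 1]` and integrating by parts with the weight `1 - x` gives `c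
  -- = ∫₀¹ u - ∫₀¹ (1 - x) v`.
  obtain ⟨L₁, h₁⟩ := exists_intervalFunctional hm zero_le_one (continuous_const (y := (1 : ℝ)))
  obtain ⟨L₂, h₂⟩ := exists_intervalFunctional hm zero_le_one
    (w := fun x => 1 - x) (by fun_prop)
  refine ⟨L₁.comp (.fst ℂ _ _) - L₂.comp (.snd ℂ _ _), fun u v c h => ?_⟩
  have hv := intervalIntegrable_rayL2 hm zero_le_one v
  have hp := integral_by_parts_primitive hv c (φ := fun x => 1 - x) (by fun_prop)
  have hd : deriv (fun x : ℝ => 1 - x) = fun _ => -1 := by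
    funext x
    simp
  have hu : ∫ x in (0 : ℝ)..1, (c + ∫ y in (0 : ℝ)..x, v y) = ∫ x in (0 : ℝ)..1, u x := by
    refine intervalIntegral.integral_congr_ae ?_
    rw [IsPrimitive, EventuallyEq, ae_restrict_iff' measurableSet_Ioi] at h
    filter_upwards [h] with x hx hx'
    rw [Set.uIoc_of_le zero_le_one] at hx'
    exact (hx hx'.1).symm
  rw [hd, intervalIntegral.integral_add] at hp
  · simp only [sub_apply, ContinuousLinearMap.comp_apply,
      ContinuousLinearMap.coe_fst', ContinuousLinearMap.coe_snd', h₁, h₂, Complex.ofReal_one,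
      one_mul, ← hu]
    simp only [Complex.ofReal_neg, Complex.ofReal_one, neg_mul, one_mul, sub_self, sub_zero,
      Complex.ofReal_zero, zero_mul, intervalIntegral.integral_neg] at hp
    linear_combination -hp
  · exact hv.continuousOn_mul (Continuous.continuousOn (by fun_prop))
  · refine ContinuousOn.intervalIntegrable ?_
    rw [Set.uIcc_of_le zero_le_one]
    exact continuousOn_const.mul ((continuousOn_primitive hm v c).mono Set.Icc_subset_Ici_self)

/-- In the limit the left side converges almost everywhere along a subsequence, and for each `x` the
right side is a bounded functional of the pair. This is why the constant is given by a continuous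
`L` and not by an existential. -/
theorem isClosed_isPrimitive {m : ℕ} (hm : 0 < m) (L : RayL2 m × RayL2 m →L[ℂ] ℂ) :
    IsClosed {p : RayL2 m × RayL2 m | IsPrimitive p.1 p.2 (L p)} := by
  refine IsSeqClosed.isClosed fun F p hF hp => ?_
  obtain ⟨ns, hns, hae⟩ := exists_subseq_tendsto_ae hm ((continuous_fst.tendsto p).comp hp)
  have hall : ∀ᵐ x ∂(volume.restrict (Set.Ioi (0 : ℝ))), ∀ n,
      (F n).1 x = L (F n) + ∫ y in (0 : ℝ)..x, (F n).2 y := ae_all_iff.2 fun n => hF n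
  change ∀ᵐ x ∂(volume.restrict (Set.Ioi (0 : ℝ))), _
  filter_upwards [hae, hall, ae_restrict_mem measurableSet_Ioi] with x h1 h2 (hx : 0 < x)
  obtain ⟨I, hI⟩ := exists_intervalFunctional hm hx.le (continuous_const (y := (1 : ℝ)))
  simp only [Complex.ofReal_one, one_mul] at hI
  have h3 : Tendsto (fun n => L (F (ns n)) + I (F (ns n)).2) atTop (𝓝 (L p + I p.2)) := by
    have hp' := hp.comp hns.tendsto_atTop
    exact ((L.continuous.tendsto p).comp hp').add
      (((I.continuous.comp continuous_snd).tendsto p).comp hp')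
  simp only [hI] at h3
  refine tendsto_nhds_unique h1 (h3.congr fun n => ?_)
  exact (h2 (ns n)).symm

theorem hasDerivAt_rayDensity_mul (m : ℕ) (p : ℝ[X]) (x : ℝ) :
    HasDerivAt (fun x => rayDensity m x * p.eval x)
      (rayDensity m x * (derivative p - 2 * X * p).eval x) x := by
  have h1 : HasDerivAt (fun x : ℝ => Real.exp (-x ^ 2)) (Real.exp (-x ^ 2) * -(2 * x)) x := by
    have := ((hasDerivAt_pow 2 x).neg).exp
    simpa using this
  have := (h1.const_mul (2 / (m * √Real.pi))).mul (p.hasDerivAt x)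
  refine this.congr_deriv ?_
  simp only [rayDensity, eval_sub, eval_mul, eval_X, eval_ofNat]
  ring

/-- In the Gaussian weight the formal adjoint of `d/dx` is `2x - d/dx`; on the half-line a boundary
term at `0` remains. -/
theorem IsPrimitive.inner_polyL {m : ℕ} (hm : 0 < m) {u v : RayL2 m} {c : ℂ}
    (h : IsPrimitive u v c) (p : ℝ[X]) :
    ⟪polyL m p, v⟫_ℂ = -(((rayDensity m 0 * p.eval 0 : ℝ) : ℂ) * c)
      - ⟪polyL m (derivative p - 2 * X * p), u⟫_ℂ := by
  set U : ℝ → ℂ := fun x => c + ∫ y in (0 : ℝ)..x, v y with hU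
  set φ : ℝ → ℝ := fun x => rayDensity m x * p.eval x with hφ
  have hd : deriv φ = fun x => rayDensity m x * (derivative p - 2 * X * p).eval x :=
    funext fun x => (hasDerivAt_rayDensity_mul m p x).deriv
  have hφc : ContDiff ℝ 1 φ := by
    rw [contDiff_one_iff_deriv, hd]
    exact ⟨fun x => (hasDerivAt_rayDensity_mul m p x).differentiableAt,
      (continuous_rayDensity m).mul (Polynomial.continuous _)⟩
  have i1 := integrableOn_polyL_mul hm p v
  have i2 : IntegrableOn (fun x => ((deriv φ x : ℝ) : ℂ) * U x) (Set.Ioi 0) := by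
    rw [hd]
    refine (integrableOn_polyL_mul hm (derivative p - 2 * X * p) u).congr ?_
    filter_upwards [h] with x hx
    rw [hx]
  have e2 : ∫ x in Set.Ioi (0 : ℝ), ((deriv φ x : ℝ) : ℂ) * U x =
      ⟪polyL m (derivative p - 2 * X * p), u⟫_ℂ := by
    rw [StarOU.inner_polyL hm, hd]
    refine integral_congr_ae ?_
    filter_upwards [h] with x hx
    rw [hx]
  have i3 : IntegrableOn (fun x => (φ x : ℂ) * U x) (Set.Ioi 0) := by
    refine (integrableOn_polyL_mul hm p u).congr ?_
    filter_upwards [h] with x hx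
    rw [hx]
  have hlim := intervalIntegral_tendsto_integral_Ioi 0 (i1.add i2) tendsto_id
  have hlim2 : Tendsto (fun R => (φ R : ℂ) * U R) atTop
      (𝓝 ((∫ x in Set.Ioi (0 : ℝ), ((φ x : ℂ) * v x + ((deriv φ x : ℝ) : ℂ) * U x))
        + φ 0 * c)) := by
    refine (hlim.add_const _).congr' ?_
    filter_upwards [eventually_ge_atTop 0] with R hR
    have := integral_by_parts_primitive (intervalIntegrable_rayL2 hm hR v) c hφc
    exact (sub_eq_iff_eq_add.1 this.symm).symm
  -- No decay of `U` is known pointwise. But `φ U` has a limit at infinity and is integrable, so the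
  -- limit is zero and the boundary term there disappears.
  have hzero := IntegrableAtFilter.eq_zero_of_tendsto
    (⟨Set.Ioi 0, Ioi_mem_atTop _, i3⟩ : IntegrableAtFilter (fun R => (φ R : ℂ) * U R) atTop)
    (fun s hs => by
      obtain ⟨b, hb⟩ := mem_atTop_sets.1 hs
      rw [← top_le_iff, ← Real.volume_Ici (a := b)]
      exact measure_mono hb) hlim2
  rw [integral_add i1 i2, e2, ← StarOU.inner_polyL hm] at hzero
  linear_combination hzero

/-! ### Hermite polynomials on the half-line. -/

/-- The Hermite polynomials, orthogonal for the weight `exp (-x²)`. -/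
def hermitePoly : ℕ → ℝ[X]
  | 0 => 1
  | n + 1 => 2 * X * hermitePoly n - derivative (hermitePoly n)

theorem derivative_hermitePoly_succ (n : ℕ) :
    derivative (hermitePoly (n + 1)) = C (2 * ((n : ℝ) + 1)) * hermitePoly n := by
  induction n with
  | zero =>
    simp [hermitePoly, map_ofNat C]
  | succ n ih =>
    have h : hermitePoly (n + 1 + 1) =
        2 * X * hermitePoly (n + 1) - derivative (hermitePoly (n + 1)) := rfl
    have h' : hermitePoly (n + 1) = 2 * X * hermitePoly n - derivative (hermitePoly n) := rfl
    rw [h, derivative_sub, derivative_mul, ih, derivative_C_mul]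
    have h2 : derivative (2 * X : ℝ[X]) = 2 := by simp
    rw [h2]
    push_cast
    simp only [C_mul, C_add, C_1, map_natCast, map_ofNat]
    rw [h']
    ring

theorem hermitePoly_add_two (n : ℕ) : hermitePoly (n + 2) =
    2 * X * hermitePoly (n + 1) - C (2 * ((n : ℝ) + 1)) * hermitePoly n := by
  rw [← derivative_hermitePoly_succ]
  rfl

theorem hermitePoly_eval_neg (n : ℕ) (x : ℝ) :
    (hermitePoly n).eval (-x) = (-1) ^ n * (hermitePoly n).eval x := by
  induction n using Nat.twoStepInduction with
  | zero => simp [hermitePoly]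
  | one => simp [hermitePoly]
  | more n h1 h2 =>
    rw [hermitePoly_add_two]
    simp only [eval_sub, eval_mul, eval_X, eval_C, eval_ofNat, h1, h2]
    ring

theorem hermitePoly_eval_zero {n : ℕ} (hn : Odd n) : (hermitePoly n).eval 0 = 0 := by
  have h := hermitePoly_eval_neg n 0
  rw [neg_zero, hn.neg_one_pow] at h
  linarith

/-- `X * H_k` is half of `H_(k+1)` plus half of the derivative of `H_k`, which is a multiple of
`H_(k-1)`; so multiplication by `X` exchanges the two parity classes. Keeping track of parity is
what completeness on the half-line requires. -/
theorem X_pow_mem_span_hermitePoly (n : ℕ) :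
    (X ^ n : ℝ[X]) ∈ Submodule.span ℝ {p | ∃ k, k % 2 = n % 2 ∧ p = hermitePoly k} := by
  induction n with
  | zero => exact Submodule.subset_span ⟨0, rfl, by simp [hermitePoly]⟩
  | succ n ih =>
    rw [pow_succ']
    have hle := (Submodule.map_span_le (LinearMap.mulLeft ℝ (X : ℝ[X]))
      {p | ∃ k, k % 2 = n % 2 ∧ p = hermitePoly k}
      (Submodule.span ℝ {p | ∃ k, k % 2 = (n + 1) % 2 ∧ p = hermitePoly k})).2 ?_
    · exact hle ⟨_, ih, rfl⟩
    · rintro _ ⟨k, hk, rfl⟩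
      change X * hermitePoly k ∈ _
      have h1 : hermitePoly (k + 1) = 2 * X * hermitePoly k - derivative (hermitePoly k) := rfl
      have hhalf : C (1 / 2 : ℝ) * 2 = 1 := by
        rw [← C_ofNat, ← C_mul]
        norm_num
      have h2 : X * hermitePoly k =
          (1 / 2 : ℝ) • hermitePoly (k + 1) + (1 / 2 : ℝ) • derivative (hermitePoly k) := by
        rw [h1, smul_eq_C_mul, smul_eq_C_mul]
        linear_combination -(X * hermitePoly k) * hhalf
      rw [h2]
      refine Submodule.add_mem _ (Submodule.smul_mem _ _ (Submodule.subset_span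
        ⟨k + 1, by omega, rfl⟩)) (Submodule.smul_mem _ _ ?_)
      cases k with
      | zero => simp [hermitePoly]
      | succ k =>
        rw [derivative_hermitePoly_succ, ← smul_eq_C_mul]
        exact Submodule.smul_mem _ _ (Submodule.subset_span ⟨k, by omega, rfl⟩)

theorem isPrimitive_polyL {m : ℕ} (hm : 0 < m) (p : ℝ[X]) :
    IsPrimitive (polyL m p) (polyL m (derivative p)) ((p.eval 0 : ℝ) : ℂ) := by
  have h2 := coeFn_polyL hm (derivative p)
  rw [EventuallyEq, ae_restrict_iff' measurableSet_Ioi] at h2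
  rw [IsPrimitive]
  filter_upwards [coeFn_polyL hm p, ae_restrict_mem measurableSet_Ioi] with x hx (hx0 : 0 < x)
  rw [hx]
  have h3 : ∫ y in (0 : ℝ)..x, polyL m (derivative p) y =
      ∫ y in (0 : ℝ)..x, (((derivative p).eval y : ℝ) : ℂ) := by
    refine intervalIntegral.integral_congr_ae ?_
    filter_upwards [h2] with y hy hy'
    rw [Set.uIoc_of_le hx0.le] at hy'
    exact hy hy'.1
  rw [h3, intervalIntegral.integral_ofReal, intervalIntegral.integral_eq_sub_of_hasDerivAt
    (fun y _ => p.hasDerivAt y) ((derivative p).continuous.intervalIntegrable _ _)]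
  push_cast
  ring

/-- The defining recursion says that the adjoint of `d/dx` raises `H_n` to `H_(n+1)`, up to the
boundary term. -/
theorem IsPrimitive.inner_hermitePoly {m : ℕ} (hm : 0 < m) {u v : RayL2 m} {c : ℂ}
    (h : IsPrimitive u v c) (n : ℕ) :
    ⟪polyL m (hermitePoly n), v⟫_ℂ = ⟪polyL m (hermitePoly (n + 1)), u⟫_ℂ
      - ((rayDensity m 0 * (hermitePoly n).eval 0 : ℝ) : ℂ) * c := by
  have h1 : derivative (hermitePoly n) - 2 * X * hermitePoly n =
      (-1 : ℝ) • hermitePoly (n + 1) := by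
    rw [hermitePoly, neg_one_smul, neg_sub]
  rw [h.inner_polyL hm, h1, polyL_smul]
  push_cast
  rw [neg_one_smul, inner_neg_left]
  ring

theorem inner_hermitePoly_zero_zero {m : ℕ} (hm : 0 < m) :
    ⟪polyL m (hermitePoly 0), polyL m (hermitePoly 0)⟫_ℂ = 1 / (m : ℂ) := by
  rw [inner_polyL hm]
  have h1 : ∫ x in Set.Ioi (0 : ℝ), ((rayDensity m x * (hermitePoly 0).eval x : ℝ) : ℂ) *
      polyL m (hermitePoly 0) x = ∫ x in Set.Ioi (0 : ℝ), ((rayDensity m x : ℝ) : ℂ) := by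
    refine integral_congr_ae ?_
    filter_upwards [coeFn_polyL hm (hermitePoly 0)] with x hx
    rw [hx]
    simp [hermitePoly]
  have h2 : ∫ x in Set.Ioi (0 : ℝ), rayDensity m x = 1 / m := by
    simp only [rayDensity]
    rw [integral_const_mul]
    have := integral_gaussian_Ioi 1
    simp only [neg_mul, one_mul, div_one] at this
    rw [this]
    have h0 : (0 : ℝ) < m := Nat.cast_pos.2 hm
    have h1 : 0 < √Real.pi := Real.sqrt_pos.2 Real.pi_pos
    field_simp
  rw [h1, integral_complex_ofReal, h2]
  push_cast
  rfl

/-- The raising identity reduces the pair `(n + 1, k + 1)` to `(n, k)`. Its boundary term contains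
`H_n(0) * H_(k+1)(0)`, where the degrees have opposite parity, so one factor is zero; this is where
equal parity of the two indices is essential. -/
theorem inner_hermitePoly {m : ℕ} (hm : 0 < m) (n k : ℕ) (hnk : n % 2 = k % 2) :
    ⟪polyL m (hermitePoly n), polyL m (hermitePoly k)⟫_ℂ =
      if n = k then ((2 ^ n * n.factorial / m : ℝ) : ℂ) else 0 := by
  have step : ∀ n, Even (n + 1) →
      ⟪polyL m (hermitePoly (n + 1)), polyL m (hermitePoly 0)⟫_ℂ = 0 := by
    intro n hn
    have h := (isPrimitive_polyL hm (hermitePoly 0)).inner_hermitePoly hm n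
    -- Written as a multiple by `0` so that `polyL_smul` turns it into the zero vector.
    have hd : derivative (hermitePoly 0) = (0 : ℝ) • (0 : ℝ[X]) := by simp [hermitePoly]
    rw [hermitePoly_eval_zero (by grind), hd, polyL_smul] at h
    simpa using h.symm
  induction n generalizing k with
  | zero =>
    cases k with
    | zero =>
      rw [inner_hermitePoly_zero_zero hm]
      simp
    | succ k =>
      rw [← inner_conj_symm, step k (by grind)]
      simp
  | succ n ih =>
    cases k with
    | zero => simp [step n (by grind)]
    | succ k =>
      have h := (isPrimitive_polyL hm (hermitePoly (k + 1))).inner_hermitePoly hm n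
      rw [derivative_hermitePoly_succ, ← smul_eq_C_mul, polyL_smul, inner_smul_right,
        ih k (by omega)] at h
      have hz : (hermitePoly n).eval 0 * (hermitePoly (k + 1)).eval 0 = 0 := by
        rcases Nat.even_or_odd n with he | ho
        · rw [hermitePoly_eval_zero (n := k + 1) (by grind), mul_zero]
        · rw [hermitePoly_eval_zero ho, zero_mul]
      rw [← Complex.ofReal_mul, mul_assoc, hz, mul_zero, Complex.ofReal_zero, sub_zero] at h
      rw [← h]
      by_cases hnk : n = k
      · subst hnk
        rw [if_pos rfl, if_pos rfl, Nat.factorial_succ, ← Complex.ofReal_mul]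
        congr 1
        push_cast
        ring
      · rw [if_neg hnk, if_neg (by omega), mul_zero]

/-- The norm of the Hermite polynomial of degree `n` on a ray. -/
def hermiteNorm (m n : ℕ) : ℝ := √(2 ^ n * n.factorial / m)

theorem hermiteNorm_pos {m : ℕ} (hm : 0 < m) (n : ℕ) : 0 < hermiteNorm m n := by
  have h0 : (0 : ℝ) < m := Nat.cast_pos.2 hm
  have h1 : (0 : ℝ) < n.factorial := Nat.cast_pos.2 n.factorial_pos
  unfold hermiteNorm
  positivity

theorem hermiteNorm_succ (m n : ℕ) :
    hermiteNorm m (n + 1) = √(2 * (n + 1)) * hermiteNorm m n := by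
  rw [hermiteNorm, hermiteNorm, ← Real.sqrt_mul (by positivity), Nat.factorial_succ]
  congr 1
  push_cast
  ring

/-- The Hermite polynomials, normalized on a ray. -/
def hermiteOn (m n : ℕ) : ℝ[X] := (hermiteNorm m n)⁻¹ • hermitePoly n

theorem derivative_hermiteOn_succ {m : ℕ} (hm : 0 < m) (n : ℕ) :
    derivative (hermiteOn m (n + 1)) = √(2 * (n + 1)) • hermiteOn m n := by
  rw [hermiteOn, hermiteOn, derivative_smul, derivative_hermitePoly_succ, ← smul_eq_C_mul,
    smul_smul, smul_smul, hermiteNorm_succ]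
  congr 1
  have h1 := hermiteNorm_pos hm n
  have h2 : 0 < √(2 * ((n : ℝ) + 1)) := Real.sqrt_pos.2 (by positivity)
  have h3 : √(2 * ((n : ℝ) + 1)) ^ 2 = 2 * ((n : ℝ) + 1) := Real.sq_sqrt (by positivity)
  field_simp
  exact h3.symm

/-- At `n = 0` the truncated index `n - 1` is `0` again, and the factor `√0` makes the right side
vanish. -/
theorem derivative_hermiteOn {m : ℕ} (hm : 0 < m) (n : ℕ) :
    derivative (hermiteOn m n) = √(2 * n) • hermiteOn m (n - 1) := by
  cases n with
  | zero => simp [hermiteOn, hermitePoly]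
  | succ n =>
    rw [derivative_hermiteOn_succ hm]
    push_cast
    rfl

theorem hermiteOn_eval_zero (m : ℕ) {n : ℕ} (hn : Odd n) : (hermiteOn m n).eval 0 = 0 := by
  rw [hermiteOn, eval_smul, hermitePoly_eval_zero hn, smul_zero]

theorem hermiteOn_ode (m n : ℕ) (x : ℝ) :
    1 / 2 * (derivative (derivative (hermiteOn m n))).eval x -
      x * (derivative (hermiteOn m n)).eval x = -(n * (hermiteOn m n).eval x) := by
  simp only [hermiteOn, derivative_smul, eval_smul, smul_eq_mul]
  cases n with
  | zero => simp [hermitePoly]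
  | succ n =>
    have h : hermitePoly (n + 1) = 2 * X * hermitePoly n - derivative (hermitePoly n) := rfl
    have h2 := congrArg (eval x) h
    rw [derivative_hermitePoly_succ, derivative_C_mul]
    simp only [eval_mul, eval_sub, eval_X, eval_C, eval_ofNat] at h2 ⊢
    rw [h2]
    push_cast
    ring

theorem inner_hermiteOn {m : ℕ} (hm : 0 < m) {n k : ℕ} (hnk : n % 2 = k % 2) :
    ⟪polyL m (hermiteOn m n), polyL m (hermiteOn m k)⟫_ℂ = if n = k then 1 else 0 := by
  rw [hermiteOn, hermiteOn, polyL_smul, polyL_smul, inner_smul_left, inner_smul_right,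
    inner_hermitePoly hm n k hnk]
  by_cases h : n = k
  · subst h
    have h1 := hermiteNorm_pos hm n
    have h2 : hermiteNorm m n ^ 2 = 2 ^ n * n.factorial / m := Real.sq_sqrt (by positivity)
    rw [if_pos rfl, if_pos rfl, ← h2, Complex.conj_ofReal, ← Complex.ofReal_mul,
      ← Complex.ofReal_mul, ← Complex.ofReal_one]
    congr 1
    field_simp
  · simp [h]

theorem norm_polyL_hermiteOn {m : ℕ} (hm : 0 < m) (n : ℕ) :
    ‖polyL m (hermiteOn m n)‖ = 1 := by
  have h := inner_hermiteOn hm (rfl : n % 2 = n % 2)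
  rw [norm_eq_sqrt_re_inner (𝕜 := ℂ), h, if_pos rfl]
  simp

theorem IsPrimitive.inner_hermiteOn {m : ℕ} (hm : 0 < m) {u v : RayL2 m} {c : ℂ}
    (h : IsPrimitive u v c) (n : ℕ) :
    ⟪polyL m (hermiteOn m n), v⟫_ℂ =
      (√(2 * (n + 1)) : ℂ) * ⟪polyL m (hermiteOn m (n + 1)), u⟫_ℂ
      - ((rayDensity m 0 * (hermiteOn m n).eval 0 : ℝ) : ℂ) * c := by
  have h1 := hermiteNorm_pos hm n
  have h2 : (√(2 * (n + 1)) : ℂ) * ((hermiteNorm m (n + 1))⁻¹ : ℝ) = ((hermiteNorm m n)⁻¹ : ℝ) := by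
    rw [← Complex.ofReal_mul, hermiteNorm_succ]
    have h2 : 0 < √(2 * ((n : ℝ) + 1)) := Real.sqrt_pos.2 (by positivity)
    congr 1
    field_simp
  rw [hermiteOn, hermiteOn, polyL_smul, polyL_smul, inner_smul_left, inner_smul_left,
    h.inner_hermitePoly hm, Complex.conj_ofReal, Complex.conj_ofReal, ← mul_assoc, h2, eval_smul,
    smul_eq_mul]
  push_cast
  ring

/-! ### Completeness -/

/-- The cosine series contains only even powers, and its partial sums against `G` are dominated by
`|G| cosh (ξ x)`, integrable by the exponential moments; so it may be integrated term by term. -/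
theorem integral_mul_cos_eq_zero {G : ℝ → ℝ}
    (hG : ∀ a : ℝ, IntegrableOn (fun x => G x * Real.exp (a * x)) (Set.Ioi 0))
    (hmom : ∀ n : ℕ, ∫ x in Set.Ioi (0 : ℝ), G x * x ^ (2 * n) = 0) (ξ : ℝ) :
    ∫ x in Set.Ioi (0 : ℝ), G x * Real.cos (ξ * x) = 0 := by
  have hG0 : AEStronglyMeasurable G (volume.restrict (Set.Ioi 0)) := by
    simpa using (hG 0).aestronglyMeasurable
  have hcosh : ∀ x : ℝ, HasSum (fun n : ℕ => |G x| * ((ξ * x) ^ (2 * n) / (2 * n).factorial))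
      (|G x| * Real.cosh (ξ * x)) := fun x => (Real.hasSum_cosh (ξ * x)).mul_left _
  have key := hasSum_integral_of_dominated_convergence
    (μ := volume.restrict (Set.Ioi (0 : ℝ)))
    (F := fun (n : ℕ) x => G x * ((-1) ^ n * (ξ * x) ^ (2 * n) / (2 * n).factorial))
    (f := fun x => G x * Real.cos (ξ * x))
    (fun n x => |G x| * ((ξ * x) ^ (2 * n) / (2 * n).factorial)) ?_ ?_ ?_ ?_ ?_
  · refine key.unique ?_
    convert! hasSum_zero with n
    have : (fun x => G x * ((-1) ^ n * (ξ * x) ^ (2 * n) / (2 * n).factorial)) =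
        fun x => ((-1) ^ n * ξ ^ (2 * n) / (2 * n).factorial) * (G x * x ^ (2 * n)) := by
      funext x
      rw [mul_pow]
      ring
    rw [this, integral_const_mul, hmom, mul_zero]
  · intro n
    exact hG0.mul (Continuous.aestronglyMeasurable (by fun_prop))
  · intro n
    refine .of_forall fun x => ?_
    have h2 : 0 ≤ (ξ * x) ^ (2 * n) := by
      rw [pow_mul]
      positivity
    rw [norm_mul, Real.norm_eq_abs, Real.norm_eq_abs, abs_div, abs_mul, abs_pow, abs_neg,
      abs_one, one_pow, one_mul, abs_of_nonneg h2, Nat.abs_cast]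
  · exact .of_forall fun x => (hcosh x).summable
  · have h1 : IntegrableOn (fun x => |G x| * Real.cosh (ξ * x)) (Set.Ioi 0) := by
      have := ((hG ξ).abs.add (hG (-ξ)).abs).const_mul (1 / 2)
      refine this.congr (.of_forall fun x => ?_)
      simp only [Pi.add_apply, abs_mul, Real.abs_exp, Real.cosh_eq, neg_mul]
      ring
    exact h1.congr (.of_forall fun x => (hcosh x).tsum_eq.symm)
  · exact .of_forall fun x => (Real.hasSum_cos (ξ * x)).mul_left _

/-- The characteristic function of a measure plus its reflection is twice the cosine transform, so
the symmetrised measures coincide. A measure without mass on `(-∞, 0]` is recovered from its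
symmetrisation by restriction to `(0, ∞)`. -/
theorem measure_eq_of_integral_cos_eq {μ ν : Measure ℝ} [IsFiniteMeasure μ] [IsFiniteMeasure ν]
    (hμ : μ (Set.Iic 0) = 0) (hν : ν (Set.Iic 0) = 0)
    (h : ∀ ξ : ℝ, ∫ x, Real.cos (ξ * x) ∂μ = ∫ x, Real.cos (ξ * x) ∂ν) : μ = ν := by
  have hchar : ∀ (ρ : Measure ℝ) [IsFiniteMeasure ρ] (ξ : ℝ),
      charFun (ρ + ρ.map (fun x => -x)) ξ = ((2 * ∫ x, Real.cos (ξ * x) ∂ρ : ℝ) : ℂ) := by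
    intro ρ _ ξ
    have hi : ∀ ζ : ℝ, Integrable (fun x : ℝ => Complex.exp (ζ * x * Complex.I)) ρ := fun ζ => by
      refine Integrable.of_bound (C := 1)
        (Continuous.aestronglyMeasurable (by fun_prop)) (.of_forall fun x => ?_)
      rw [← Complex.ofReal_mul, Complex.norm_exp_ofReal_mul_I]
    have hmap : ∫ x, Complex.exp (ξ * x * Complex.I) ∂(ρ.map fun x => -x) =
        ∫ x : ℝ, Complex.exp (ξ * ((-x : ℝ) : ℂ) * Complex.I) ∂ρ :=
      integral_map measurable_neg.aemeasurable (Continuous.aestronglyMeasurable (by fun_prop))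
    have hi2 : Integrable (fun x : ℝ => Complex.exp (ξ * ((-x : ℝ) : ℂ) * Complex.I)) ρ := by
      refine (hi (-ξ)).congr (.of_forall fun x => ?_)
      simp
    rw [charFun_apply_real, integral_add_measure (hi ξ), hmap, ← integral_add (hi ξ) hi2,
      ← integral_const_mul, ← integral_complex_ofReal]
    · congr 1
      funext x
      push_cast
      rw [Complex.cos]
      ring_nf
    · refine Integrable.of_bound (C := 1)
        (Continuous.aestronglyMeasurable (by fun_prop)) (.of_forall fun x => ?_)
      rw [← Complex.ofReal_mul, Complex.norm_exp_ofReal_mul_I]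
  have hsym : μ + μ.map (fun x => -x) = ν + ν.map (fun x => -x) := by
    refine Measure.ext_of_charFun (funext fun ξ => ?_)
    rw [hchar, hchar, h]
  have hres : ∀ (ρ : Measure ℝ), ρ (Set.Iic 0) = 0 → ∀ s, MeasurableSet s →
      ρ s = (ρ + ρ.map (fun x => -x)) (s ∩ Set.Ioi 0) := by
    intro ρ hρ s hs
    have hms : MeasurableSet (s ∩ Set.Ioi (0 : ℝ)) := hs.inter measurableSet_Ioi
    have h1 : (ρ.map fun x => -x) (s ∩ Set.Ioi 0) = 0 := by
      rw [Measure.map_apply measurable_neg hms]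
      refine measure_mono_null (fun x hx => ?_) hρ
      have : 0 < -x := hx.2
      exact Set.mem_Iic.2 (by linarith)
    rw [Measure.add_apply, h1, add_zero]
    have h2 : ρ (s \ Set.Ioi 0) = 0 :=
      measure_mono_null (fun x hx => Set.mem_Iic.2 (not_lt.1 hx.2)) hρ
    rw [← measure_inter_add_sdiff s (measurableSet_Ioi (a := (0 : ℝ))), h2, add_zero]
  ext s hs
  rw [hres μ hμ s hs, hres ν hν s hs, hsym]

/-- The positive and negative parts of `G` are densities of two finite measures on the half-line
with equal cosine transforms; hence they agree, and since at each point one of them is zero, so is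
`G`. -/
theorem ae_eq_zero_of_even_moments {G : ℝ → ℝ}
    (hG : ∀ a : ℝ, IntegrableOn (fun x => G x * Real.exp (a * x)) (Set.Ioi 0))
    (hmom : ∀ n : ℕ, ∫ x in Set.Ioi (0 : ℝ), G x * x ^ (2 * n) = 0) :
    ∀ᵐ x ∂(volume.restrict (Set.Ioi (0 : ℝ))), G x = 0 := by
  set μ := volume.restrict (Set.Ioi (0 : ℝ)) with hμ
  have hGi : Integrable G μ := by
    have := hG 0
    simp only [zero_mul, Real.exp_zero, mul_one] at this
    exact this
  have hm1 : AEMeasurable (fun x => ENNReal.ofReal (G x)) μ := hGi.aemeasurable.ennreal_ofReal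
  have hm2 : AEMeasurable (fun x => ENNReal.ofReal (-G x)) μ :=
    hGi.neg.aemeasurable.ennreal_ofReal
  have hf1 := isFiniteMeasure_withDensity_ofReal hGi.2
  have hf2 : IsFiniteMeasure (μ.withDensity fun x => ENNReal.ofReal (-G x)) :=
    isFiniteMeasure_withDensity_ofReal hGi.neg.2
  have hnull : ∀ f : ℝ → ENNReal, μ.withDensity f (Set.Iic 0) = 0 := fun f => by
    refine withDensity_absolutelyContinuous _ _ ?_
    rw [hμ, Measure.restrict_apply measurableSet_Iic, Set.inter_comm, Set.Ioi_inter_Iic,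
      Set.Ioc_self, measure_empty]
  have hpos : Integrable (fun x => max (G x) 0) μ := hGi.pos_part
  have hneg : Integrable (fun x => max (-G x) 0) μ := hGi.neg_part
  have hcos : ∀ (ξ : ℝ) {F : ℝ → ℝ}, Integrable F μ →
      Integrable (fun x => F x * Real.cos (ξ * x)) μ := fun ξ F hF =>
    hF.mul_bdd (c := 1) (Continuous.aestronglyMeasurable (by fun_prop))
      (.of_forall fun x => Real.abs_cos_le_one _)
  have heq : (μ.withDensity fun x => ENNReal.ofReal (G x)) =
      μ.withDensity fun x => ENNReal.ofReal (-G x) :=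
    measure_eq_of_integral_cos_eq (hnull _) (hnull _) (fun ξ => by
    rw [integral_withDensity_eq_integral_toReal_smul₀ hm1 (by simp),
      integral_withDensity_eq_integral_toReal_smul₀ hm2 (by simp), ← sub_eq_zero]
    simp only [ENNReal.toReal_ofReal', smul_eq_mul]
    rw [← integral_sub (hcos ξ hpos) (hcos ξ hneg)]
    refine Eq.trans ?_ (integral_mul_cos_eq_zero hG hmom ξ)
    congr 1
    funext x
    rw [← sub_mul, max_zero_sub_max_neg_zero_eq_self])
  have h := (withDensity_eq_iff hm1 hm2 (by
    have := hGi.lintegral_lt_top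
    exact this.ne)).1 heq
  filter_upwards [h] with x hx
  rcases le_total 0 (G x) with h0 | h0
  · rw [ENNReal.ofReal_of_nonpos (by linarith : -G x ≤ 0), ENNReal.ofReal_eq_zero] at hx
    linarith
  · rw [ENNReal.ofReal_of_nonpos h0, eq_comm, ENNReal.ofReal_eq_zero] at hx
    linarith

theorem integrableOn_density_pow_exp (m : ℕ) (e : ℕ) (a : ℝ) :
    IntegrableOn (fun x => (rayDensity m x * x ^ e * Real.exp (a * x)) ^ 2 * Real.exp (x ^ 2))
      (Set.Ioi 0) := by
  have h := ((integrable_eval_mul_gaussian one_pos a (X ^ (2 * e))).const_mul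
    ((2 / (m * √Real.pi)) ^ 2 * Real.exp (a ^ 2))).integrableOn (s := Set.Ioi 0)
  refine h.congr_fun (fun x _ => ?_) measurableSet_Ioi
  simp only [rayDensity, eval_pow, eval_X]
  have h1 : Real.exp (a ^ 2) * Real.exp (-1 * (a - x) ^ 2) =
      Real.exp (-x ^ 2) ^ 2 * Real.exp (a * x) ^ 2 * Real.exp (x ^ 2) := by
    rw [← Real.exp_add, ← Real.exp_nat_mul, ← Real.exp_nat_mul, ← Real.exp_add, ← Real.exp_add]
    congr 1
    push_cast
    ring
  calc (2 / (m * √Real.pi)) ^ 2 * Real.exp (a ^ 2) * (x ^ (2 * e) * Real.exp (-1 * (a - x) ^ 2))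
      = (2 / (m * √Real.pi)) ^ 2 * x ^ (2 * e) *
        (Real.exp (a ^ 2) * Real.exp (-1 * (a - x) ^ 2)) := by ring
    _ = _ := by
      rw [h1]
      ring

/-- The Hermite polynomials of a fixed parity are complete on the half-line. -/
theorem eq_zero_of_inner_hermitePoly {m : ℕ} (hm : 0 < m) {e : ℕ} (he : e < 2) (g : RayL2 m)
    (h : ∀ n, ⟪polyL m (hermitePoly (2 * n + e)), g⟫_ℂ = 0) : g = 0 := by
  have hpow : ∀ n, ⟪polyL m (X ^ (2 * n + e)), g⟫_ℂ = 0 := by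
    intro n
    refine Submodule.span_induction (p := fun p _ => ⟪polyL m p, g⟫_ℂ = 0) ?_ ?_ ?_ ?_
      (X_pow_mem_span_hermitePoly (2 * n + e))
    · rintro _ ⟨k, hk, rfl⟩
      have : k = 2 * (k / 2) + e := by omega
      rw [this]
      exact h _
    · have : polyL m 0 = 0 := by simpa using polyL_smul m 0 0
      rw [this, inner_zero_left]
    · intro p q _ _ hp hq
      rw [polyL_add, inner_add_left, hp, hq, add_zero]
    · intro c p _ hp
      rw [polyL_smul, inner_smul_left, hp, mul_zero]
  -- Absorbing `x ^ e` into the weighted function turns odd moments into even ones, so both parities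
  -- use the same moment lemma.
  set W : ℝ → ℂ := fun x => ((rayDensity m x * x ^ e : ℝ) : ℂ) * g x with hW
  have hWexp : ∀ a : ℝ, IntegrableOn (fun x => (Real.exp (a * x) : ℂ) * W x) (Set.Ioi 0) := by
    intro a
    obtain ⟨L, hL⟩ := exists_functional hm (φ := fun x => rayDensity m x * x ^ e *
      Real.exp (a * x)) (by
        have := continuous_rayDensity m
        exact Continuous.measurable (by fun_prop)) (integrableOn_density_pow_exp m e a)
    refine (hL g).1.congr (.of_forall fun x => ?_)
    simp only [hW]
    push_cast
    ring
  have hWpow : ∀ n : ℕ, IntegrableOn (fun x => ((x ^ (2 * n) : ℝ) : ℂ) * W x) (Set.Ioi 0) ∧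
      ∫ x in Set.Ioi (0 : ℝ), ((x ^ (2 * n) : ℝ) : ℂ) * W x = 0 := by
    intro n
    have hE : (fun x => ((rayDensity m x * (X ^ (2 * n + e) : ℝ[X]).eval x : ℝ) : ℂ) * g x) =
        fun x => ((x ^ (2 * n) : ℝ) : ℂ) * W x := by
      funext x
      simp only [hW, eval_pow, eval_X]
      push_cast
      ring
    have h1 := integrableOn_polyL_mul hm (X ^ (2 * n + e)) g
    have h2 := hpow n
    rw [inner_polyL hm] at h2
    rw [hE] at h1 h2
    exact ⟨h1, h2⟩
  have key : ∀ L : ℂ →L[ℝ] ℝ, ∀ᵐ x ∂(volume.restrict (Set.Ioi (0 : ℝ))), L (W x) = 0 := by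
    intro L
    have hL : ∀ (r : ℝ) (z : ℂ), L z * r = L ((r : ℂ) * z) := fun r z => by
      rw [← Complex.real_smul, map_smul, smul_eq_mul, mul_comm]
    refine ae_eq_zero_of_even_moments (fun a => ?_) fun n => ?_
    · simp only [hL]
      exact L.integrable_comp (hWexp a)
    · simp only [hL]
      rw [L.integral_comp_comm (hWpow n).1, (hWpow n).2, map_zero]
  rw [Lp.eq_zero_iff_ae_eq_zero]
  change ∀ᵐ x ∂(rayMeasure m), g x = 0
  rw [ae_rayMeasure hm]
  filter_upwards [key Complex.reCLM, key Complex.imCLM, ae_restrict_mem measurableSet_Ioi]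
    with x h1 h2 (hx : 0 < x)
  have h3 : W x = 0 := Complex.ext h1 h2
  have h4 : rayDensity m x * x ^ e ≠ 0 := (mul_pos (rayDensity_pos hm x) (pow_pos hx e)).ne'
  rcases mul_eq_zero.1 h3 with h5 | h5
  · exact absurd (Complex.ofReal_eq_zero.1 h5) h4
  · exact h5

/-! ### The Gaussian kernel -/

/-- The derivative of `q` times the Gaussian has integral zero over the line. -/
theorem integral_gaussian_by_parts {s : ℝ} (hs : 0 < s) (c : ℝ) (q : ℝ[X]) :
    ∫ y, (2 * X * q).eval y * Real.exp (-s * (c - y) ^ 2) =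
      2 * c * (∫ y, q.eval y * Real.exp (-s * (c - y) ^ 2)) +
        s⁻¹ * ∫ y, (derivative q).eval y * Real.exp (-s * (c - y) ^ 2) := by
  have hI := integrable_eval_mul_gaussian hs c
  have hd : ∀ y, HasDerivAt (fun y => q.eval y * Real.exp (-s * (c - y) ^ 2))
      ((derivative q + C (2 * s) * (C c - X) * q).eval y * Real.exp (-s * (c - y) ^ 2)) y := by
    intro y
    have h1 : HasDerivAt (fun y : ℝ => -s * (c - y) ^ 2) (2 * s * (c - y)) y := by
      have := (((hasDerivAt_id y).const_sub c).pow 2).const_mul (-s)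
      refine this.congr_deriv ?_
      simp
      ring
    refine ((q.hasDerivAt y).mul h1.exp).congr_deriv ?_
    simp only [eval_add, eval_mul, eval_sub, eval_X, eval_C]
    ring
  have h0 := integral_eq_zero_of_hasDerivAt_of_integrable hd (hI _) (hI q)
  have hsplit : ∀ y, (derivative q + C (2 * s) * (C c - X) * q).eval y *
      Real.exp (-s * (c - y) ^ 2) = (derivative q).eval y * Real.exp (-s * (c - y) ^ 2) +
      (2 * s * c) * (q.eval y * Real.exp (-s * (c - y) ^ 2)) -
      s * ((2 * X * q).eval y * Real.exp (-s * (c - y) ^ 2)) := by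
    intro y
    simp only [eval_add, eval_mul, eval_sub, eval_X, eval_C, eval_ofNat]
    ring
  simp only [hsplit] at h0
  have hI2 : Integrable fun y => (derivative q).eval y * Real.exp (-s * (c - y) ^ 2) +
      (2 * s * c) * (q.eval y * Real.exp (-s * (c - y) ^ 2)) := (hI _).add ((hI _).const_mul _)
  rw [integral_sub hI2 ((hI _).const_mul _), integral_add (hI _) ((hI _).const_mul _), integral_const_mul, integral_const_mul] at h0
  have hs' : s⁻¹ * s = 1 := inv_mul_cancel₀ hs.ne'
  generalize (∫ y, (2 * X * q).eval y * Real.exp (-s * (c - y) ^ 2)) = I₁ at h0 ⊢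
  generalize (∫ y, q.eval y * Real.exp (-s * (c - y) ^ 2)) = I₂ at h0 ⊢
  linear_combination -s⁻¹ * h0 - (I₁ - 2 * c * I₂) * hs'

/-- Mehler's formula. Integration by parts produces the derivative of `H_n` with coefficient `s⁻¹ -
1`, which the normalisation turns into `-a²`; both sides then satisfy the same three-term recursion.
It is used with `a = exp (-t)` and `s⁻¹ = 1 - exp (-2t)`. -/
theorem integral_gaussian_hermitePoly {a s : ℝ} (hs : 0 < s) (has : a ^ 2 + s⁻¹ = 1) (x : ℝ)
    (n : ℕ) : ∫ y, (hermitePoly n).eval y * Real.exp (-s * (a * x - y) ^ 2) =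
      √(Real.pi / s) * (a ^ n * (hermitePoly n).eval x) := by
  have h0 : ∫ y, (hermitePoly 0).eval y * Real.exp (-s * (a * x - y) ^ 2) = √(Real.pi / s) := by
    simp only [hermitePoly, eval_one, one_mul]
    rw [integral_sub_left_eq_self (fun y => Real.exp (-s * y ^ 2)), integral_gaussian]
  have hstep : ∀ n, ∫ y, (hermitePoly (n + 1)).eval y * Real.exp (-s * (a * x - y) ^ 2) =
      2 * (a * x) * (∫ y, (hermitePoly n).eval y * Real.exp (-s * (a * x - y) ^ 2)) -
      a ^ 2 * ∫ y, (derivative (hermitePoly n)).eval y * Real.exp (-s * (a * x - y) ^ 2) := by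
    intro n
    have hI := integrable_eval_mul_gaussian hs (a * x)
    simp only [hermitePoly, eval_sub, sub_mul]
    rw [integral_sub (hI _) (hI _), integral_gaussian_by_parts hs]
    linear_combination (∫ y, (derivative (hermitePoly n)).eval y *
      Real.exp (-s * (a * x - y) ^ 2)) * has
  induction n using Nat.twoStepInduction with
  | zero =>
    rw [h0]
    simp [hermitePoly]
  | one =>
    rw [hstep 0, h0]
    simp [hermitePoly]
    ring
  | more n h1 h2 =>
    rw [hstep (n + 1), h2, derivative_hermitePoly_succ, hermitePoly_add_two]
    simp only [eval_mul, eval_C, mul_assoc, integral_const_mul, h1, eval_sub, eval_X, eval_ofNat]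
    ring

/-- Folds the integral over the line at `0`; the sign of the reflected kernel is the parity of
`H_n`. -/
theorem integral_Ioi_gaussian_hermitePoly {a s : ℝ} (hs : 0 < s) (has : a ^ 2 + s⁻¹ = 1) (x : ℝ)
    (n : ℕ) : ∫ y in Set.Ioi (0 : ℝ), (Real.exp (-s * (a * x - y) ^ 2) +
      (-1) ^ n * Real.exp (-s * (a * x + y) ^ 2)) * (hermitePoly n).eval y =
      √(Real.pi / s) * (a ^ n * (hermitePoly n).eval x) := by
  have hI := integrable_eval_mul_gaussian hs (a * x) (hermitePoly n)
  have hI' := hI.comp_neg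
  rw [← integral_gaussian_hermitePoly hs has x n,
    ← intervalIntegral.integral_Iic_add_Ioi (b := 0) hI.integrableOn hI.integrableOn,
    ← neg_zero, ← integral_comp_neg_Ioi, neg_zero, ← integral_add hI'.integrableOn hI.integrableOn]
  congr 1
  funext y
  rw [hermitePoly_eval_neg, sub_neg_eq_add]
  ring

/-! ### A Hilbert basis of the star -/

/-- An orthonormal basis of `ℂ^m` that contains a constant vector. -/
theorem exists_adapted_basis {m : ℕ} (k₀ : Fin m) :
    ∃ w : OrthonormalBasis (Fin m) ℂ (EuclideanSpace ℂ (Fin m)),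
      (∀ i j, w k₀ i = w k₀ j) ∧ ∀ k, k ≠ k₀ → ∑ i, w k i = 0 := by
  have hm : (0 : ℝ) < m := Nat.cast_pos.2 (Nat.lt_of_le_of_lt (Nat.zero_le _) k₀.2)
  set r : ℂ := (((√m)⁻¹ : ℝ) : ℂ) with hr
  have hr0 : r ≠ 0 := by
    rw [hr, Ne, Complex.ofReal_eq_zero, inv_eq_zero]
    exact (Real.sqrt_pos.2 hm).ne'
  set v : Fin m → EuclideanSpace ℂ (Fin m) := fun _ => WithLp.toLp 2 fun _ => r with hv
  have hon : Orthonormal ℂ (({k₀} : Set (Fin m)).domRestrict v) := by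
    constructor
    · rintro ⟨i, hi⟩
      have hn : ‖r‖ ^ 2 = (m : ℝ)⁻¹ := by
        rw [hr, Complex.norm_real, Real.norm_eq_abs, sq_abs, inv_pow, Real.sq_sqrt hm.le]
      change ‖(WithLp.toLp 2 fun _ => r : EuclideanSpace ℂ (Fin m))‖ = 1
      simp only [EuclideanSpace.norm_eq, Finset.sum_const, Finset.card_univ, Fintype.card_fin,
        nsmul_eq_mul, hn]
      rw [mul_inv_cancel₀ hm.ne', Real.sqrt_one]
    · rintro ⟨i, hi⟩ ⟨j, hj⟩ hij
      rw [Set.mem_singleton_iff] at hi hj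
      exact absurd (Subtype.ext (hi.trans hj.symm)) hij
  obtain ⟨w, hw⟩ := hon.exists_orthonormalBasis_extension_of_card_eq (by simp)
  have hw0 : ∀ i, w k₀ i = r := fun i => by rw [hw k₀ rfl]
  refine ⟨w, fun i j => by rw [hw0, hw0], fun k hk => ?_⟩
  have h : ⟪w k₀, w k⟫_ℂ = 0 := w.orthonormal.2 hk.symm
  rw [PiLp.inner_apply] at h
  simp only [RCLike.inner_apply', hw0, ← Finset.mul_sum] at h
  exact (mul_eq_zero.1 h).resolve_left (by simpa using hr0)

/-- The function `i ↦ a i • p` on the star, for a vector `a` and a polynomial `p`. -/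
def tens {m : ℕ} (a : EuclideanSpace ℂ (Fin m)) (p : ℝ[X]) : StarL2 m :=
  WithLp.toLp 2 fun i => a i • polyL m p

theorem tens_apply {m : ℕ} (a : EuclideanSpace ℂ (Fin m)) (p : ℝ[X]) (i : Fin m) :
    tens a p i = a i • polyL m p := rfl

theorem inner_tens_left {m : ℕ} (a : EuclideanSpace ℂ (Fin m)) (p : ℝ[X]) (f : StarL2 m) :
    ⟪tens a p, f⟫_ℂ = ∑ i, starRingEnd ℂ (a i) * ⟪polyL m p, f i⟫_ℂ := by
  rw [PiLp.inner_apply]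
  simp only [tens_apply, inner_smul_left]

theorem inner_tens_tens {m : ℕ} (a b : EuclideanSpace ℂ (Fin m)) (p q : ℝ[X]) :
    ⟪tens a p, tens b q⟫_ℂ = ⟪a, b⟫_ℂ * ⟪polyL m p, polyL m q⟫_ℂ := by
  rw [inner_tens_left, PiLp.inner_apply, Finset.sum_mul]
  simp only [tens_apply, inner_smul_right, RCLike.inner_apply', mul_assoc]

theorem norm_tens {m : ℕ} (a : EuclideanSpace ℂ (Fin m)) (p : ℝ[X]) :
    ‖tens a p‖ = ‖a‖ * ‖polyL m p‖ := by
  have h : ‖tens a p‖ ^ 2 = (‖a‖ * ‖polyL m p‖) ^ 2 := by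
    have := inner_tens_tens a a p p
    simp only [inner_self_eq_norm_sq_to_K] at this
    rw [mul_pow]
    exact_mod_cast this
  exact (sq_eq_sq₀ (norm_nonneg _) (by positivity)).1 h

/-- The degree of the polynomial in the basis vector with the index `p`: even on the constant
vector, odd on the vectors of mean zero. -/
def level {m : ℕ} (k₀ : Fin m) (p : Fin m × ℕ) : ℕ := 2 * p.2 + if p.1 = k₀ then 0 else 1

theorem level_even {m : ℕ} (k₀ : Fin m) (n : ℕ) : Even (level k₀ (k₀, n)) := by
  simp [level]

theorem level_odd {m : ℕ} {k₀ k : Fin m} (hk : k ≠ k₀) (n : ℕ) : Odd (level k₀ (k, n)) := by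
  simp [level, hk]

theorem level_succ {m : ℕ} (k₀ k : Fin m) (n : ℕ) :
    level k₀ (k, n + 1) = level k₀ (k, n) + 2 := by
  simp only [level]
  ring

theorem level_mod {m : ℕ} (k₀ k : Fin m) (n n' : ℕ) :
    level k₀ (k, n) % 2 = level k₀ (k, n') % 2 := by
  simp only [level]
  omega

theorem level_injective {m : ℕ} (k₀ k : Fin m) {n n' : ℕ}
    (h : level k₀ (k, n) = level k₀ (k, n')) : n = n' := by
  simp only [level] at h
  omega

/-- The completeness relation of `w` inverts the change of coordinates on `m`-tuples of vectors. -/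
theorem eq_zero_of_sum_conj_smul {m : ℕ} {V : Type*} [AddCommGroup V] [Module ℂ V]
    (w : OrthonormalBasis (Fin m) ℂ (EuclideanSpace ℂ (Fin m))) (f : Fin m → V)
    (h : ∀ k, ∑ i, starRingEnd ℂ (w k i) • f i = 0) (j : Fin m) : f j = 0 := by
  have hw : ∀ i, ∑ k, starRingEnd ℂ (w k i) * w k j = if j = i then 1 else 0 := by
    intro i
    have h1 := w.sum_repr' (EuclideanSpace.single i (1 : ℂ))
    have h2 := congrArg (fun z : EuclideanSpace ℂ (Fin m) => z j) h1
    simpa [EuclideanSpace.inner_single_right, Pi.single_apply] using h2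
  calc f j = ∑ i, (if j = i then (1 : ℂ) else 0) • f i := by simp
    _ = ∑ i, ∑ k, w k j • starRingEnd ℂ (w k i) • f i := by
      refine Finset.sum_congr rfl fun i _ => ?_
      rw [← hw, Finset.sum_smul]
      refine Finset.sum_congr rfl fun k _ => ?_
      rw [smul_smul, mul_comm]
    _ = 0 := by
      rw [Finset.sum_comm]
      simp only [← Finset.smul_sum, h, smul_zero, Finset.sum_const_zero]

/-- Different `k` are orthogonal through `w`, equal `k` through Hermite polynomials of one parity.
If `f` is orthogonal to all the vectors, each combination `∑ conj (w k i) • f i` is orthogonal to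
all Hermite polynomials of one parity, hence zero, and inverting `w` gives `f = 0`. -/
theorem exists_hermiteBasis {m : ℕ} (hm : 0 < m) (k₀ : Fin m)
    (w : OrthonormalBasis (Fin m) ℂ (EuclideanSpace ℂ (Fin m))) :
    ∃ b : HilbertBasis (Fin m × ℕ) ℂ (StarL2 m),
      ∀ p, b p = tens (w p.1) (hermiteOn m (level k₀ p)) := by
  have hon : Orthonormal ℂ fun p : Fin m × ℕ => tens (w p.1) (hermiteOn m (level k₀ p)) := by
    constructor
    · rintro ⟨k, n⟩
      rw [norm_tens, norm_polyL_hermiteOn hm, w.orthonormal.norm_eq_one, mul_one]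
    · rintro ⟨k, n⟩ ⟨k', n'⟩ hne
      rw [inner_tens_tens]
      by_cases hk : k = k'
      · subst hk
        rw [inner_hermiteOn hm (level_mod k₀ k n n'), if_neg, mul_zero]
        exact fun h => hne (by rw [level_injective k₀ k h])
      · rw [w.orthonormal.2 hk, zero_mul]
  have hbot : (Submodule.span ℂ (Set.range fun p : Fin m × ℕ =>
      tens (w p.1) (hermiteOn m (level k₀ p))))ᗮ = ⊥ := by
    rw [Submodule.eq_bot_iff]
    intro f hf
    have hf' : ∀ k n, ⟪tens (w k) (hermiteOn m (level k₀ (k, n))), f⟫_ℂ = 0 := fun k n =>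
      (Submodule.mem_orthogonal _ _).1 hf _ (Submodule.subset_span ⟨(k, n), rfl⟩)
    have hsum : ∀ k, ∑ i, starRingEnd ℂ (w k i) • f i = 0 := by
      intro k
      refine eq_zero_of_inner_hermitePoly hm (e := if k = k₀ then 0 else 1)
        (by split_ifs <;> norm_num) _ fun n => ?_
      have h1 := hf' k n
      rw [inner_tens_left] at h1
      simp only [← inner_smul_right, ← inner_sum] at h1
      rw [hermiteOn, polyL_smul, inner_smul_left, Complex.conj_ofReal] at h1
      exact (mul_eq_zero.1 h1).resolve_left
        (Complex.ofReal_ne_zero.2 (inv_ne_zero (hermiteNorm_pos hm _).ne'))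
    ext1 i
    exact eq_zero_of_sum_conj_smul w (fun i => f i) hsum i
  exact ⟨HilbertBasis.mkOfOrthogonalEqBot hon hbot, fun p => by
    rw [HilbertBasis.coe_mkOfOrthogonalEqBot]⟩

/-! ### The integral formula -/

theorem exists_gaussianFunctional {m : ℕ} (hm : 0 < m) {s : ℝ} (hs : 1 < s) (c : ℝ) :
    ∃ L : RayL2 m →L[ℂ] ℂ, ∀ f : RayL2 m,
      IntegrableOn (fun y => (Real.exp (-s * (c - y) ^ 2) : ℂ) * f y) (Set.Ioi 0) ∧
      L f = ∫ y in Set.Ioi (0 : ℝ), (Real.exp (-s * (c - y) ^ 2) : ℂ) * f y := by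
  refine exists_functional hm (φ := fun y => Real.exp (-s * (c - y) ^ 2))
    (Continuous.measurable (by fun_prop)) ?_
  -- The centre and the prefactor below come from completing the square in `y² - 2s (c - y)²`, whose
  -- leading coefficient is `-(2s - 1)`.
  have h0 : 0 < 2 * s - 1 := by linarith
  have h := ((integrable_eval_mul_gaussian h0 (2 * s * c / (2 * s - 1)) 1).const_mul
    (Real.exp ((2 * s * c) ^ 2 / (2 * s - 1) - 2 * s * c ^ 2))).integrableOn (s := Set.Ioi 0)
  refine h.congr_fun (fun y _ => ?_) measurableSet_Ioi
  simp only [eval_one, one_mul]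
  rw [← Real.exp_add, ← Real.exp_nat_mul, ← Real.exp_add]
  congr 1
  push_cast
  field_simp
  ring

/-- The value of the integral formula at a point is a bounded functional. -/
theorem exists_ouFunctional {m : ℕ} (hm : 0 < m) {t : ℝ} (ht : 0 < t) (i : Fin m) (x : ℝ) :
    ∃ L : StarL2 m →L[ℂ] ℂ, ∀ f, L f = ouFormula t f i x := by
  have he : Real.exp (-2 * t) < 1 := by
    rw [← Real.exp_zero]
    exact Real.exp_lt_exp.2 (by linarith)
  have hs : 1 < (1 - Real.exp (-2 * t))⁻¹ := by
    rw [one_lt_inv₀ (by linarith)]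
    linarith [Real.exp_pos (-2 * t)]
  obtain ⟨L₁, h₁⟩ := exists_gaussianFunctional hm hs (Real.exp (-t) * x)
  obtain ⟨L₂, h₂⟩ := exists_gaussianFunctional hm hs (-(Real.exp (-t) * x))
  have hneg : ∀ y : ℝ, (-(Real.exp (-t) * x) - y) ^ 2 = (Real.exp (-t) * x + y) ^ 2 :=
    fun y => by ring
  simp only [hneg] at h₂
  let pr : ∀ j : Fin m, StarL2 m →L[ℂ] RayL2 m := fun j => PiLp.proj 2 (fun _ => RayL2 m) j
  refine ⟨((1 / √(Real.pi * (1 - Real.exp (-2 * t))) : ℝ) : ℂ) • ((L₁ - L₂).comp (pr i)) +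
    ((2 / (m * √(Real.pi * (1 - Real.exp (-2 * t)))) : ℝ) : ℂ) • ∑ j, L₂.comp (pr j),
    fun f => ?_⟩
  have hpr : ∀ j, pr j f = f j := fun j => rfl
  simp only [add_apply, smul_apply, ContinuousLinearMap.comp_apply, sub_apply, sum_apply, hpr,
    (h₁ _).2, (h₂ _).2, smul_eq_mul, ouFormula]
  rw [← integral_sub (h₁ _).1 (h₂ _).1]
  congr 3
  funext y
  push_cast
  ring

/-- On the constant vector the sum over the rays cancels `1 / m` and adds twice the reflected
kernel, turning its sign from `-1` to `+1`; on mean-zero vectors that sum vanishes and the sign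
stays `-1`. Either way the sign is `(-1) ^ N`, as the folded Mehler formula requires. -/
theorem ouFormula_tens {m : ℕ} (hm : 0 < m) {t : ℝ} (ht : 0 < t) (k₀ : Fin m)
    (w : OrthonormalBasis (Fin m) ℂ (EuclideanSpace ℂ (Fin m))) (hw : ∀ i j, w k₀ i = w k₀ j)
    (hw' : ∀ k, k ≠ k₀ → ∑ i, w k i = 0) (p : Fin m × ℕ) (i : Fin m) (x : ℝ) :
    ouFormula t (tens (w p.1) (hermiteOn m (level k₀ p))) i x =
      (Real.exp (-(level k₀ p * t)) : ℂ) *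
        (w p.1 i * (((hermiteOn m (level k₀ p)).eval x : ℝ) : ℂ)) := by
  obtain ⟨k, n⟩ := p
  set N := level k₀ (k, n) with hN
  have he : Real.exp (-2 * t) < 1 := by
    rw [← Real.exp_zero]
    exact Real.exp_lt_exp.2 (by linarith)
  set s : ℝ := (1 - Real.exp (-2 * t))⁻¹ with hs
  have hs0 : 0 < s := inv_pos.2 (by linarith)
  set a : ℝ := Real.exp (-t) with ha
  have has : a ^ 2 + s⁻¹ = 1 := by
    rw [hs, inv_inv, ha, ← Real.exp_nat_mul]
    push_cast
    ring_nf
  have hZ : √(Real.pi * (1 - Real.exp (-2 * t))) = √(Real.pi / s) := by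
    rw [hs, div_inv_eq_mul]
  set Z : ℝ := √(Real.pi / s) with hZdef
  have hZ0 : 0 < Z := Real.sqrt_pos.2 (div_pos Real.pi_pos hs0)
  set q := hermiteOn m N with hq
  have hI : ∀ c : ℝ, IntegrableOn (fun y => q.eval y * Real.exp (-s * (c - y) ^ 2)) (Set.Ioi 0) :=
    fun c => (integrable_eval_mul_gaussian hs0 c q).integrableOn
  have hneg : ∀ y : ℝ, (-(a * x) - y) ^ 2 = (a * x + y) ^ 2 := fun y => by ring
  have hI2 := hI (-(a * x))
  simp only [hneg] at hI2
  set J₁ : ℝ := ∫ y in Set.Ioi (0 : ℝ), q.eval y * Real.exp (-s * (a * x - y) ^ 2) with hJ₁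
  set J₂ : ℝ := ∫ y in Set.Ioi (0 : ℝ), q.eval y * Real.exp (-s * (a * x + y) ^ 2) with hJ₂
  have hcoe : ∀ j, ∀ᵐ y ∂(volume.restrict (Set.Ioi (0 : ℝ))),
      tens (w k) q j y = w k j * ((q.eval y : ℝ) : ℂ) := by
    intro j
    have h1 := Lp.coeFn_smul (w k j) (polyL m q)
    rw [EventuallyEq, ae_rayMeasure hm] at h1
    filter_upwards [h1, coeFn_polyL hm q] with y h1 h2
    rw [tens_apply, h1, Pi.smul_apply, h2, smul_eq_mul]
  have e1 : ∫ y in Set.Ioi (0 : ℝ), ((Real.exp (-s * (a * x - y) ^ 2) -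
      Real.exp (-s * (a * x + y) ^ 2) : ℝ) : ℂ) * tens (w k) q i y = w k i * ((J₁ - J₂ : ℝ) : ℂ) := by
    rw [hJ₁, hJ₂, ← integral_sub (hI _) hI2, ← integral_complex_ofReal, ← integral_const_mul]
    refine integral_congr_ae ?_
    filter_upwards [hcoe i] with y hy
    rw [hy]
    push_cast
    ring
  have e2 : ∀ j, ∫ y in Set.Ioi (0 : ℝ), ((Real.exp (-s * (a * x + y) ^ 2) : ℝ) : ℂ) *
      tens (w k) q j y = w k j * (J₂ : ℂ) := by
    intro j
    rw [hJ₂, ← integral_complex_ofReal, ← integral_const_mul]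
    refine integral_congr_ae ?_
    filter_upwards [hcoe j] with y hy
    rw [hy]
    push_cast
    ring
  have hJ : J₁ + (-1) ^ N * J₂ = Z * (a ^ N * q.eval x) := by
    have h := integral_Ioi_gaussian_hermitePoly hs0 has x N
    rw [hJ₁, hJ₂, ← integral_const_mul, ← integral_add (hI _) (hI2.const_mul _)]
    simp only [hq, hermiteOn, eval_smul, smul_eq_mul]
    calc _ = ∫ y in Set.Ioi (0 : ℝ), (hermiteNorm m N)⁻¹ * ((Real.exp (-s * (a * x - y) ^ 2) +
          (-1) ^ N * Real.exp (-s * (a * x + y) ^ 2)) * (hermitePoly N).eval y) := by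
          congr 1
          funext y
          ring
      _ = _ := by
          rw [integral_const_mul, h]
          ring
  have haN : a ^ N = Real.exp (-(N * t)) := by
    rw [ha, ← Real.exp_nat_mul]
    ring_nf
  have hm0 : (m : ℂ) ≠ 0 := Nat.cast_ne_zero.2 hm.ne'
  have hZc : (Z : ℂ) ≠ 0 := Complex.ofReal_ne_zero.2 hZ0.ne'
  have hJc := congrArg (fun r : ℝ => (r : ℂ)) hJ
  push_cast at hJc
  rw [ouFormula, hZ, e1, Finset.sum_congr rfl fun j _ => e2 j, ← Finset.sum_mul, ← haN]
  by_cases hk : k = k₀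
  · have hev : Even N := by
      rw [hN, hk]
      exact level_even k₀ n
    have hsum : ∑ j, w k j = m * w k i := by
      rw [Finset.sum_congr rfl fun j _ => (by rw [hk, hw j i] : w k j = w k₀ i)]
      simp [hk]
    rw [hev.neg_one_pow, one_mul] at hJc
    rw [hsum]
    push_cast
    field_simp
    linear_combination w k i * hJc
  · have hodd : Odd N := level_odd hk n
    rw [hodd.neg_one_pow] at hJc
    rw [hw' k hk, zero_mul, mul_zero, add_zero]
    push_cast
    field_simp
    linear_combination w k i * hJc

theorem IsDiagonalSemigroup.apply_basis {ι H : Type*} [NormedAddCommGroup H]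
    [InnerProductSpace ℂ H] {b : HilbertBasis ι ℂ H} {lam : ι → ℝ} {T : ℝ → H →L[ℂ] H}
    (hT : IsDiagonalSemigroup b lam T) {t : ℝ} (ht : 0 ≤ t) (i : ι) :
    T t (b i) = (Real.exp (-(lam i * t)) : ℂ) • b i := by
  refine ext_coeff b fun j => ?_
  rw [hT t ht, inner_smul_right]
  by_cases h : j = i
  · rw [h]
  · rw [b.orthonormal.2 h, mul_zero, mul_zero]

/-- The identity holds on basis vectors and hence on their span. For a limit of such vectors, `T t`
converges almost everywhere along a subsequence, while the formula converges at every `x` because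
its value there is a bounded functional. -/
theorem IsDiagonalSemigroup.isOUSemigroup {m : ℕ} (hm : 0 < m) (k₀ : Fin m)
    (w : OrthonormalBasis (Fin m) ℂ (EuclideanSpace ℂ (Fin m))) (hw : ∀ i j, w k₀ i = w k₀ j)
    (hw' : ∀ k, k ≠ k₀ → ∑ i, w k i = 0) {b : HilbertBasis (Fin m × ℕ) ℂ (StarL2 m)}
    (hb : ∀ p, b p = tens (w p.1) (hermiteOn m (level k₀ p)))
    {T : ℝ → StarL2 m →L[ℂ] StarL2 m}
    (hT : IsDiagonalSemigroup b (fun p => (level k₀ p : ℝ)) T) : IsOUSemigroup T := by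
  refine ⟨?_, fun t ht f i => ?_⟩
  · exact (hT.isC₀Semigroup fun p => Nat.cast_nonneg _).zero
  rw [ae_rayMeasure hm]
  choose L hL using fun x : ℝ => exists_ouFunctional hm ht i x
  simp only [← hL]
  have hspan : ∀ g ∈ Submodule.span ℂ (Set.range b),
      ∀ᵐ x ∂(volume.restrict (Set.Ioi (0 : ℝ))), T t g i x = L x g := by
    intro g hg
    refine Submodule.span_induction (p := fun g _ =>
      ∀ᵐ x ∂(volume.restrict (Set.Ioi (0 : ℝ))), T t g i x = L x g) ?_ ?_ ?_ ?_ hg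
    · rintro _ ⟨p, rfl⟩
      have h1 := Lp.coeFn_smul ((Real.exp (-(level k₀ p * t)) : ℂ) * w p.1 i)
        (polyL m (hermiteOn m (level k₀ p)))
      rw [EventuallyEq, ae_rayMeasure hm] at h1
      filter_upwards [h1, coeFn_polyL hm (hermiteOn m (level k₀ p))] with x h1 h2
      rw [hL, hT.apply_basis ht.le, hb, ouFormula_tens hm ht k₀ w hw hw', PiLp.smul_apply,
        tens_apply, smul_smul, h1, Pi.smul_apply, h2, smul_eq_mul, mul_assoc]
    · have h1 := Lp.coeFn_zero ℂ 2 (rayMeasure m)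
      rw [EventuallyEq, ae_rayMeasure hm] at h1
      filter_upwards [h1] with x h1
      rw [map_zero, map_zero, PiLp.zero_apply, h1, Pi.zero_apply]
    · intro g h _ _ hg hh
      have h1 := Lp.coeFn_add (T t g i) (T t h i)
      rw [EventuallyEq, ae_rayMeasure hm] at h1
      filter_upwards [h1, hg, hh] with x h1 h2 h3
      rw [map_add, map_add, PiLp.add_apply, h1, Pi.add_apply, h2, h3]
    · intro c g _ hg
      have h1 := Lp.coeFn_smul c (T t g i)
      rw [EventuallyEq, ae_rayMeasure hm] at h1
      filter_upwards [h1, hg] with x h1 h2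
      rw [map_smul, map_smul, PiLp.smul_apply, h1, Pi.smul_apply, h2]
  have hf : f ∈ closure (Submodule.span ℂ (Set.range b) : Set (StarL2 m)) := by
    rw [← Submodule.topologicalClosure_coe, b.dense_span]
    trivial
  obtain ⟨F, hF, hlim⟩ := mem_closure_iff_seq_limit.1 hf
  have hTlim : Tendsto (fun n => T t (F n) i) atTop (𝓝 (T t f i)) :=
    (((PiLp.proj 2 (fun _ : Fin m => RayL2 m) i : StarL2 m →L[ℂ] RayL2 m).continuous.comp
      (T t).continuous).tendsto f).comp hlim
  obtain ⟨ns, hns, hae⟩ := exists_subseq_tendsto_ae hm hTlim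
  filter_upwards [hae, ae_all_iff.2 fun n => hspan _ (hF n)] with x h1 h2
  refine tendsto_nhds_unique h1 ?_
  simp only [h2]
  exact (((L x).continuous.tendsto f).comp hlim).comp hns.tendsto_atTop

/-! ### The generator -/

/-- The pairs `(u, v)` such that `u` is a primitive of `v` with the boundary value `L (u, v)`. -/
def primitiveSubmodule {m : ℕ} (hm : 0 < m) (L : RayL2 m × RayL2 m →L[ℂ] ℂ) :
    Submodule ℂ (RayL2 m × RayL2 m) where
  carrier := {p | IsPrimitive p.1 p.2 (L p)}
  zero_mem' := by
    have h1 := Lp.coeFn_zero ℂ 2 (rayMeasure m)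
    rw [EventuallyEq, ae_rayMeasure hm] at h1
    have h2 := h1
    rw [ae_restrict_iff' measurableSet_Ioi] at h2
    change ∀ᵐ x ∂(volume.restrict (Set.Ioi (0 : ℝ))), _
    filter_upwards [h1, ae_restrict_mem measurableSet_Ioi] with x hx (hx0 : 0 < x)
    have h3 : ∫ y in (0 : ℝ)..x, (0 : RayL2 m) y = ∫ y in (0 : ℝ)..x, (0 : ℂ) := by
      refine intervalIntegral.integral_congr_ae ?_
      filter_upwards [h2] with y hy hy'
      rw [Set.uIoc_of_le hx0.le] at hy'
      exact hy hy'.1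
    rw [Prod.fst_zero, Prod.snd_zero, hx, h3]
    simp
  add_mem' := by
    rintro ⟨u, v⟩ ⟨u', v'⟩ hp hq
    have h1 := Lp.coeFn_add u u'
    have h2 := Lp.coeFn_add v v'
    rw [EventuallyEq, ae_rayMeasure hm] at h1 h2
    rw [ae_restrict_iff' measurableSet_Ioi] at h2
    change ∀ᵐ x ∂(volume.restrict (Set.Ioi (0 : ℝ))), _
    filter_upwards [h1, hp, hq, ae_restrict_mem measurableSet_Ioi] with x hx hpx hqx (hx0 : 0 < x)
    have h3 : ∫ y in (0 : ℝ)..x, (v + v') y = ∫ y in (0 : ℝ)..x, (v y + v' y) := by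
      refine intervalIntegral.integral_congr_ae ?_
      filter_upwards [h2] with y hy hy'
      rw [Set.uIoc_of_le hx0.le] at hy'
      exact hy hy'.1
    rw [intervalIntegral.integral_add (intervalIntegrable_rayL2 hm hx0.le v)
      (intervalIntegrable_rayL2 hm hx0.le v')] at h3
    rw [map_add]
    change (u + u') x = _ + ∫ y in (0 : ℝ)..x, (v + v') y
    rw [hx, h3, Pi.add_apply, hpx, hqx]
    ring
  smul_mem' := by
    rintro c ⟨u, v⟩ hp
    have h1 := Lp.coeFn_smul c u
    have h2 := Lp.coeFn_smul c v
    rw [EventuallyEq, ae_rayMeasure hm] at h1 h2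
    rw [ae_restrict_iff' measurableSet_Ioi] at h2
    change ∀ᵐ x ∂(volume.restrict (Set.Ioi (0 : ℝ))), _
    filter_upwards [h1, hp, ae_restrict_mem measurableSet_Ioi] with x hx hpx (hx0 : 0 < x)
    have h3 : ∫ y in (0 : ℝ)..x, (c • v) y = ∫ y in (0 : ℝ)..x, c * v y := by
      refine intervalIntegral.integral_congr_ae ?_
      filter_upwards [h2] with y hy hy'
      rw [Set.uIoc_of_le hx0.le] at hy'
      exact hy hy'.1
    rw [intervalIntegral.integral_const_mul] at h3
    rw [map_smul]
    change (c • u) x = _ + ∫ y in (0 : ℝ)..x, (c • v) y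
    rw [hx, h3, Pi.smul_apply, hpx, smul_eq_mul, smul_eq_mul]
    ring

/-- The triples `(g, u, v)` with `g = v / 2 - x u` almost everywhere. -/
def odeSubmodule {m : ℕ} (hm : 0 < m) : Submodule ℂ (RayL2 m × RayL2 m × RayL2 m) where
  carrier := {p | ∀ᵐ x ∂(volume.restrict (Set.Ioi (0 : ℝ))),
    p.1 x = (1 / 2 : ℂ) * p.2.2 x - (x : ℂ) * p.2.1 x}
  zero_mem' := by
    have h1 := Lp.coeFn_zero ℂ 2 (rayMeasure m)
    rw [EventuallyEq, ae_rayMeasure hm] at h1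
    change ∀ᵐ x ∂(volume.restrict (Set.Ioi (0 : ℝ))), _
    filter_upwards [h1] with x hx
    simp only [Prod.fst_zero, Prod.snd_zero, hx, Pi.zero_apply]
    simp
  add_mem' := by
    rintro ⟨g, u, v⟩ ⟨g', u', v'⟩ hp hq
    have h0 := Lp.coeFn_add g g'
    have h1 := Lp.coeFn_add u u'
    have h2 := Lp.coeFn_add v v'
    rw [EventuallyEq, ae_rayMeasure hm] at h0 h1 h2
    change ∀ᵐ x ∂(volume.restrict (Set.Ioi (0 : ℝ))), _
    filter_upwards [h0, h1, h2, hp, hq] with x h0 h1 h2 hp hq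
    simp only [Prod.mk_add_mk, h0, h1, h2, Pi.add_apply] at hp hq ⊢
    linear_combination hp + hq
  smul_mem' := by
    rintro c ⟨g, u, v⟩ hp
    have h0 := Lp.coeFn_smul c g
    have h1 := Lp.coeFn_smul c u
    have h2 := Lp.coeFn_smul c v
    rw [EventuallyEq, ae_rayMeasure hm] at h0 h1 h2
    change ∀ᵐ x ∂(volume.restrict (Set.Ioi (0 : ℝ))), _
    filter_upwards [h0, h1, h2, hp] with x h0 h1 h2 hp
    simp only [Prod.smul_mk, h0, h1, h2, Pi.smul_apply, smul_eq_mul] at hp ⊢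
    linear_combination c * hp

/-- Multiplication by `x` is unbounded on this `L²` space, so the limit is taken pointwise, along a
subsequence refined successively for the three components. -/
theorem isClosed_odeSubmodule {m : ℕ} (hm : 0 < m) :
    IsClosed (odeSubmodule hm : Set (RayL2 m × RayL2 m × RayL2 m)) := by
  refine IsSeqClosed.isClosed fun F p hF hp => ?_
  obtain ⟨n₁, h₁, a₁⟩ := exists_subseq_tendsto_ae hm ((continuous_fst.tendsto p).comp hp)
  have hp₁ := hp.comp h₁.tendsto_atTop
  obtain ⟨n₂, h₂, a₂⟩ := exists_subseq_tendsto_ae hm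
    (((continuous_fst.comp continuous_snd).tendsto p).comp hp₁)
  have hp₂ := hp₁.comp h₂.tendsto_atTop
  obtain ⟨n₃, h₃, a₃⟩ := exists_subseq_tendsto_ae hm
    (((continuous_snd.comp continuous_snd).tendsto p).comp hp₂)
  have hall : ∀ᵐ x ∂(volume.restrict (Set.Ioi (0 : ℝ))), ∀ n,
      (F n).1 x = (1 / 2 : ℂ) * (F n).2.2 x - (x : ℂ) * (F n).2.1 x :=
    ae_all_iff.2 fun n => hF n
  change ∀ᵐ x ∂(volume.restrict (Set.Ioi (0 : ℝ))), _
  filter_upwards [a₁, a₂, a₃, hall] with x b₁ b₂ b₃ hx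
  have c₁ := b₁.comp (h₂.comp h₃).tendsto_atTop
  have c₂ := b₂.comp h₃.tendsto_atTop
  refine tendsto_nhds_unique c₁ (((b₃.const_mul (1 / 2 : ℂ)).sub (c₂.const_mul (x : ℂ))).congr
    fun n => ?_)
  exact (hx _).symm

theorem mem_of_hasSum_of_isClosed {ι V : Type*} [NormedAddCommGroup V] [NormedSpace ℂ V]
    {S : Submodule ℂ V} (hS : IsClosed (S : Set V)) {v : ι → V} {x : V} (h : HasSum v x)
    (hv : ∀ i, v i ∈ S) : x ∈ S :=
  hS.mem_of_tendsto h (.of_forall fun _ => S.sum_mem fun i _ => hv i)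

theorem tens_smul {m : ℕ} (a : EuclideanSpace ℂ (Fin m)) (r : ℝ) (p : ℝ[X]) :
    tens a (r • p) = (r : ℂ) • tens a p := by
  ext1 i
  rw [PiLp.smul_apply, tens_apply, tens_apply, polyL_smul, smul_comm]

/-- Lowering all degrees by the same `j` preserves both parity agreement and distinctness. The
bounds on `j` keep truncated subtraction from identifying two degrees. -/
theorem inner_tens_sub_eq_zero {m : ℕ} (hm : 0 < m) (k₀ : Fin m)
    (w : OrthonormalBasis (Fin m) ℂ (EuclideanSpace ℂ (Fin m))) (j : ℕ)
    {p q : Fin m × ℕ} (hpq : p ≠ q)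
    (hp : j ≤ level k₀ p) (hq : j ≤ level k₀ q) :
    ⟪tens (w p.1) (hermiteOn m (level k₀ p - j)),
      tens (w q.1) (hermiteOn m (level k₀ q - j))⟫_ℂ = 0 := by
  obtain ⟨k, n⟩ := p
  obtain ⟨k', n'⟩ := q
  rw [inner_tens_tens]
  by_cases hk : k = k'
  · subst hk
    have hmod := level_mod k₀ k n n'
    rw [inner_hermiteOn hm (by omega), if_neg, mul_zero]
    intro h
    exact hpq (by rw [level_injective k₀ k (by omega : level k₀ (k, n) = level k₀ (k, n'))])
  · rw [w.orthonormal.2 hk, zero_mul]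

theorem summable_tens_sub {m : ℕ} (hm : 0 < m) (k₀ : Fin m)
    (w : OrthonormalBasis (Fin m) ℂ (EuclideanSpace ℂ (Fin m))) (j : ℕ)
    (a : Fin m × ℕ → ℂ) (ha : ∀ p, level k₀ p < j → a p = 0)
    (hs : Summable fun p => ‖a p‖ ^ 2) :
    Summable fun p => a p • tens (w p.1) (hermiteOn m (level k₀ p - j)) := by
  refine summable_of_pairwise_orthogonal (fun p q hpq => ?_) ?_
  · beta_reduce
    rw [inner_smul_left, inner_smul_right]
    rcases lt_or_ge (level k₀ p) j with hp | hp
    · rw [ha p hp, map_zero, zero_mul]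
    rcases lt_or_ge (level k₀ q) j with hq | hq
    · rw [ha q hq, zero_mul, mul_zero]
    rw [inner_tens_sub_eq_zero hm k₀ w j hpq hp hq, mul_zero, mul_zero]
  · simpa only [norm_smul, norm_tens, norm_polyL_hermiteOn hm, w.orthonormal.norm_eq_one,
      mul_one] using hs

/-- One and two derivatives lower the degree `N` by one and two, with squared factors `2N ≤ 2N²` and
`4N(N-1) ≤ 4N²`; so square summability of `N * c` controls both series. -/
theorem summable_derivatives {m : ℕ} (hm : 0 < m) (k₀ : Fin m)
    (w : OrthonormalBasis (Fin m) ℂ (EuclideanSpace ℂ (Fin m)))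
    (c : Fin m × ℕ → ℂ)
    (hs : Summable fun p => ‖(level k₀ p : ℂ) * c p‖ ^ 2) :
    (Summable fun p => c p • tens (w p.1) (derivative (hermiteOn m (level k₀ p)))) ∧
    Summable fun p => c p • tens (w p.1) (derivative (derivative (hermiteOn m (level k₀ p)))) := by
  constructor
  · have h := summable_tens_sub hm k₀ w 1 (fun p => c p * (√(2 * level k₀ p) : ℝ)) (fun p hp => by
      rw [Nat.lt_one_iff.1 hp]
      simp) (by
      refine Summable.of_nonneg_of_le (fun p => by positivity) (fun p => ?_) (hs.mul_left 2)
      rw [norm_mul, norm_mul, mul_pow, mul_pow, Complex.norm_real, Real.norm_eq_abs, sq_abs,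
        Real.sq_sqrt (by positivity), Complex.norm_natCast]
      have h1 : (level k₀ p : ℝ) ≤ (level k₀ p : ℝ) ^ 2 := by
        exact_mod_cast Nat.le_self_pow two_ne_zero (level k₀ p)
      have h2 := mul_le_mul_of_nonneg_right h1 (sq_nonneg ‖c p‖)
      linarith)
    refine h.congr fun p => ?_
    rw [derivative_hermiteOn hm, tens_smul, smul_smul]
  · have h := summable_tens_sub hm k₀ w 2
      (fun p => c p * ((√(2 * level k₀ p) * √(2 * (level k₀ p - 1 : ℕ)) : ℝ) : ℂ)) (fun p hp => by
      have h1 : level k₀ p - 1 = 0 := by omega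
      rw [h1]
      simp) (by
      refine Summable.of_nonneg_of_le (fun p => by positivity) (fun p => ?_) (hs.mul_left 4)
      rw [norm_mul, norm_mul, mul_pow, mul_pow, Complex.norm_real, Real.norm_eq_abs, sq_abs,
        mul_pow, Real.sq_sqrt (by positivity), Real.sq_sqrt (by positivity), Complex.norm_natCast]
      have h1 : ((level k₀ p - 1 : ℕ) : ℝ) ≤ level k₀ p := Nat.cast_le.2 (Nat.sub_le _ _)
      have h2 : (0 : ℝ) ≤ level k₀ p := Nat.cast_nonneg _
      have h3 := mul_le_mul_of_nonneg_right (mul_le_mul_of_nonneg_left h1 h2) (sq_nonneg ‖c p‖)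
      linarith)
    refine h.congr fun p => ?_
    rw [derivative_hermiteOn hm, derivative_smul, derivative_hermiteOn hm, smul_smul, tens_smul,
      smul_smul, Nat.sub_sub]

theorem hasSum_of_forall_eq {ι V : Type*} [AddCommMonoid V] [TopologicalSpace V] {u v : ι → V}
    {x : V} (h : ∀ i, u i = v i) (hu : HasSum u x) : HasSum v x :=
  funext h ▸ hu

theorem hasSum_apply {ι : Type*} {m : ℕ} {v : ι → StarL2 m} {f : StarL2 m} (h : HasSum v f)
    (i : Fin m) : HasSum (fun p => v p i) (f i) :=
  h.mapL (PiLp.proj 2 (fun _ : Fin m => RayL2 m) i : StarL2 m →L[ℂ] RayL2 m)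

/-- The Hermite series of `f` is differentiated term by term; weak derivatives and the differential
equation survive because the relations are closed. Boundary values are series of boundary values by
continuity of `L`: at `0` the mean-zero terms of `f` vanish and the constant ones agree on all rays,
while for `f₁` the constant terms vanish and the mean-zero ones cancel over the rays. -/
theorem exists_derivatives_of_coeff {m : ℕ} (hm : 0 < m) (k₀ : Fin m)
    (w : OrthonormalBasis (Fin m) ℂ (EuclideanSpace ℂ (Fin m))) (hw : ∀ i j, w k₀ i = w k₀ j)
    (hw' : ∀ k, k ≠ k₀ → ∑ i, w k i = 0) {b : HilbertBasis (Fin m × ℕ) ℂ (StarL2 m)}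
    (hb : ∀ p, b p = tens (w p.1) (hermiteOn m (level k₀ p))) {f g : StarL2 m}
    (h : ∀ p, ⟪b p, g⟫_ℂ = -(((level k₀ p : ℕ) : ℝ) : ℂ) * ⟪b p, f⟫_ℂ) :
    ∃ f₁ f₂ : StarL2 m, HasDerivs f f₁ f₂ ∧ (∃ c : ℂ, ∀ i, HasValueAtZero (f i) c) ∧
      (∃ d : Fin m → ℂ, (∀ i, HasValueAtZero (f₁ i) (d i)) ∧ ∑ i, d i = 0) ∧
      ∀ i, ∀ᵐ x ∂(rayMeasure m), g i x = (1 / 2 : ℂ) * f₂ i x - (x : ℂ) * f₁ i x := by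
  set c : Fin m × ℕ → ℂ := fun p => ⟪b p, f⟫_ℂ with hc
  obtain ⟨s₁, s₂⟩ := summable_derivatives hm k₀ w c (by
    refine (hasSum_norm_sq_coeff b g).summable.congr fun p => ?_
    rw [h p, neg_mul, norm_neg]
    push_cast
    rfl)
  obtain ⟨f₁, hf₁⟩ := s₁
  obtain ⟨f₂, hf₂⟩ := s₂
  have hf : HasSum (fun p => c p • tens (w p.1) (hermiteOn m (level k₀ p))) f := by
    refine hasSum_of_forall_eq (fun p => ?_) (b.hasSum_repr f)
    rw [b.repr_apply_apply, ← hb]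
  have hg : HasSum (fun p => (-(((level k₀ p : ℕ) : ℝ) : ℂ) * c p) •
      tens (w p.1) (hermiteOn m (level k₀ p))) g := by
    refine hasSum_of_forall_eq (fun p => ?_) (b.hasSum_repr g)
    rw [b.repr_apply_apply, h, ← hb]
  obtain ⟨L, hL⟩ := exists_boundaryFunctional hm
  have hLp : ∀ p : ℝ[X], L (polyL m p, polyL m (derivative p)) = ((p.eval 0 : ℝ) : ℂ) :=
    fun p => hL _ _ _ (isPrimitive_polyL hm p)
  have hcl : IsClosed (primitiveSubmodule hm L : Set (RayL2 m × RayL2 m)) :=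
    isClosed_isPrimitive hm L
  have hmem : ∀ p : ℝ[X], (polyL m p, polyL m (derivative p)) ∈ primitiveSubmodule hm L := by
    intro p
    change IsPrimitive (polyL m p) (polyL m (derivative p)) _
    rw [hLp]
    exact isPrimitive_polyL hm p
  have hpair : ∀ (i : Fin m) (P : Fin m × ℕ → ℝ[X]) (u v : StarL2 m),
      HasSum (fun p => c p • tens (w p.1) (P p)) u →
      HasSum (fun p => c p • tens (w p.1) (derivative (P p))) v →
      IsPrimitive (u i) (v i) (L (u i, v i)) ∧
      HasSum (fun p => c p * (w p.1 i * (((P p).eval 0 : ℝ) : ℂ))) (L (u i, v i)) := by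
    intro i P u v hu hv
    have hsum := (hasSum_apply hu i).prodMk (hasSum_apply hv i)
    have hterm : ∀ p, ((c p • tens (w p.1) (P p)) i, (c p • tens (w p.1) (derivative (P p))) i) =
        (c p * w p.1 i) • (polyL m (P p), polyL m (derivative (P p))) := by
      intro p
      rw [PiLp.smul_apply, PiLp.smul_apply, tens_apply, tens_apply, smul_smul, smul_smul,
        Prod.smul_mk]
    simp only [hterm] at hsum
    refine ⟨mem_of_hasSum_of_isClosed hcl hsum fun p => Submodule.smul_mem _ _ (hmem _), ?_⟩
    have := hsum.mapL L
    simp only [map_smul, hLp, smul_eq_mul, mul_assoc] at this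
    exact this
  have h01 := fun i => hpair i _ f f₁ hf hf₁
  have h12 := fun i => hpair i _ f₁ f₂ hf₁ hf₂
  refine ⟨f₁, f₂, fun i => ⟨(h01 i).1.isWeakDeriv hm, (h12 i).1.isWeakDeriv hm⟩,
    ⟨L (f k₀, f₁ k₀), fun i => ?_⟩,
    ⟨fun i => L (f₁ i, f₂ i), fun i => (h12 i).1.hasValueAtZero hm, ?_⟩, fun i => ?_⟩
  · have heq : L (f i, f₁ i) = L (f k₀, f₁ k₀) := by
      refine (h01 i).2.unique (hasSum_of_forall_eq (fun p => ?_) (h01 k₀).2)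
      obtain ⟨k, n⟩ := p
      by_cases hk : k = k₀
      · simp only [hk, hw k₀ i]
      · simp only [hermiteOn_eval_zero m (level_odd hk n), Complex.ofReal_zero, mul_zero]
    rw [← heq]
    exact (h01 i).1.hasValueAtZero hm
  · refine (hasSum_sum fun i _ => (h12 i).2).unique
      (hasSum_of_forall_eq (fun p => ?_) hasSum_zero)
    symm
    obtain ⟨k, n⟩ := p
    rw [← Finset.mul_sum, ← Finset.sum_mul]
    by_cases hk : k = k₀
    · have h0 : (derivative (hermiteOn m (level k₀ (k, n)))).eval 0 = 0 := by
        rw [derivative_hermiteOn hm, eval_smul, smul_eq_mul]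
        have he : Even (level k₀ (k, n)) := by
          rw [hk]
          exact level_even k₀ n
        -- At level `0` the truncated predecessor is even, so the vanishing comes from the factor
        -- `√0` and not from parity.
        rcases Nat.eq_zero_or_pos (level k₀ (k, n)) with hz | hz
        · rw [hk] at hz
          simp [hk, hz]
        · rw [hermiteOn_eval_zero m (Nat.Even.sub_odd hz he odd_one), mul_zero]
      simp only [h0, Complex.ofReal_zero, mul_zero]
    · rw [hw' k hk, zero_mul, mul_zero]
  · rw [ae_rayMeasure hm]
    have hsum := (hasSum_apply hg i).prodMk ((hasSum_apply hf₁ i).prodMk (hasSum_apply hf₂ i))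
    refine mem_of_hasSum_of_isClosed (isClosed_odeSubmodule hm) hsum fun p => ?_
    set N := level k₀ p with hN
    have hP : (polyL m ((-(N : ℝ)) • hermiteOn m N), polyL m (derivative (hermiteOn m N)),
        polyL m (derivative (derivative (hermiteOn m N)))) ∈ odeSubmodule hm := by
      change ∀ᵐ x ∂(volume.restrict (Set.Ioi (0 : ℝ))), _
      filter_upwards [coeFn_polyL hm ((-(N : ℝ)) • hermiteOn m N),
        coeFn_polyL hm (derivative (hermiteOn m N)),
        coeFn_polyL hm (derivative (derivative (hermiteOn m N)))] with x h1 h2 h3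
      simp only [h1, h2, h3, eval_smul, smul_eq_mul]
      have := congrArg (fun r : ℝ => (r : ℂ)) (hermiteOn_ode m N x)
      push_cast at this ⊢
      rw [this]
      ring
    convert! Submodule.smul_mem _ (c p * w p.1 i) hP using 1
    rw [PiLp.smul_apply, PiLp.smul_apply, PiLp.smul_apply, tens_apply, tens_apply, tens_apply,
      smul_smul, smul_smul, smul_smul, Prod.smul_mk, Prod.smul_mk, polyL_smul, smul_smul]
    congr 2
    push_cast
    ring

/-- Summed over the rays, the boundary terms become the value of the polynomial at `0` times the
pairing of `a` with the boundary values; it suffices that one factor vanishes. -/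
theorem inner_tens_of_isPrimitive {m : ℕ} (hm : 0 < m) (a : EuclideanSpace ℂ (Fin m))
    {u v : StarL2 m} {c : Fin m → ℂ} (h : ∀ i, IsPrimitive (u i) (v i) (c i)) (n : ℕ)
    (h0 : (hermiteOn m n).eval 0 = 0 ∨ ∑ i, starRingEnd ℂ (a i) * c i = 0) :
    ⟪tens a (hermiteOn m n), v⟫_ℂ =
      ((√(2 * (n + 1)) : ℝ) : ℂ) * ⟪tens a (hermiteOn m (n + 1)), u⟫_ℂ := by
  rw [inner_tens_left, inner_tens_left]
  calc ∑ i, starRingEnd ℂ (a i) * ⟪polyL m (hermiteOn m n), v i⟫_ℂ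
      = ∑ i, (((√(2 * (n + 1)) : ℝ) : ℂ) *
          (starRingEnd ℂ (a i) * ⟪polyL m (hermiteOn m (n + 1)), u i⟫_ℂ) -
          ((rayDensity m 0 * (hermiteOn m n).eval 0 : ℝ) : ℂ) * (starRingEnd ℂ (a i) * c i)) := by
        refine Finset.sum_congr rfl fun i _ => ?_
        rw [(h i).inner_hermiteOn hm]
        ring
    _ = _ := by
        rw [Finset.sum_sub_distrib, ← Finset.mul_sum, ← Finset.mul_sum]
        rcases h0 with h0 | h0 <;> simp [h0]

/-- Raising twice expresses the coefficient of `f₂` at level `N` as `2 √((N+1)(N+2))` times that of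
`f` at level `N + 2`, and `(N+2)² ≤ 4 (N+1)(N+2)`. On the constant vector the boundary terms vanish
by the Kirchhoff condition and then by oddness of `H_(N+1)`; on mean-zero vectors by oddness of
`H_N` and then by continuity at the centre. -/
theorem summable_of_mem_domain {m : ℕ} (hm : 0 < m) (k₀ : Fin m)
    (w : OrthonormalBasis (Fin m) ℂ (EuclideanSpace ℂ (Fin m))) (hw : ∀ i j, w k₀ i = w k₀ j)
    (hw' : ∀ k, k ≠ k₀ → ∑ i, w k i = 0) {b : HilbertBasis (Fin m × ℕ) ℂ (StarL2 m)}
    (hb : ∀ p, b p = tens (w p.1) (hermiteOn m (level k₀ p))) {f : StarL2 m}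
    (hf : f ∈ domainA₂ m) :
    Summable fun p => ‖-(((level k₀ p : ℕ) : ℝ) : ℂ) * ⟪b p, f⟫_ℂ‖ ^ 2 := by
  obtain ⟨f₁, f₂, hd, ⟨c, hc⟩, d, hdv, hd0⟩ := hf
  have h01 : ∀ i, IsPrimitive (f i) (f₁ i) c := by
    intro i
    obtain ⟨c', hc'⟩ := (hd i).1.exists_isPrimitive hm
    rwa [← hc'.eq_of_hasValueAtZero hm (hc i)]
  have h12 : ∀ i, IsPrimitive (f₁ i) (f₂ i) (d i) := by
    intro i
    obtain ⟨c', hc'⟩ := (hd i).2.exists_isPrimitive hm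
    rwa [← hc'.eq_of_hasValueAtZero hm (hdv i)]
  have hrec : ∀ k n, ⟪b (k, n), f₂⟫_ℂ = ((√(2 * (level k₀ (k, n) + 1)) *
      √(2 * ((level k₀ (k, n) + 1 : ℕ) + 1)) : ℝ) : ℂ) * ⟪b (k, n + 1), f⟫_ℂ := by
    intro k n
    rw [hb, hb, level_succ, inner_tens_of_isPrimitive hm (w k) h12,
      inner_tens_of_isPrimitive hm (w k) h01]
    · push_cast
      ring
    · by_cases hk : k = k₀
      · left
        refine hermiteOn_eval_zero m ?_
        rw [hk]
        exact (level_even k₀ n).add_one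
      · right
        rw [← Finset.sum_mul, ← map_sum, hw' k hk, map_zero, zero_mul]
    · by_cases hk : k = k₀
      · right
        simp only [hk, hw _ k₀]
        rw [← Finset.mul_sum, hd0, mul_zero]
      · exact Or.inl (hermiteOn_eval_zero m (level_odd hk n))
  have hsum := (hasSum_norm_sq_coeff b f₂).summable
  rw [summable_prod_of_nonneg fun p => by positivity]
  refine ⟨fun k => ?_, (hasSum_fintype _).summable⟩
  -- The recursion never reaches the coefficient with `n = 0`; for each `k` this is a single term
  -- and does not affect summability.
  rw [← summable_nat_add_iff 1]
  refine Summable.of_nonneg_of_le (fun n => by positivity) (fun n => ?_)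
    (hsum.prod_factor k)
  rw [hrec, norm_mul, norm_mul, mul_pow, mul_pow, norm_neg, Complex.norm_real, Complex.norm_real,
    Real.norm_eq_abs, Real.norm_eq_abs, sq_abs, sq_abs, mul_pow, Real.sq_sqrt (by positivity),
    Real.sq_sqrt (by positivity), level_succ]
  gcongr
  push_cast
  have : (0 : ℝ) ≤ level k₀ (k, n) := Nat.cast_nonneg _
  nlinarith

theorem summable_exp_level {m : ℕ} (k₀ : Fin m) {t : ℝ} (ht : 0 < t) :
    Summable fun p : Fin m × ℕ => Real.exp (-((level k₀ p : ℝ) * t)) := by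
  rw [summable_prod_of_nonneg fun p => (Real.exp_pos _).le]
  refine ⟨fun k => ?_, (hasSum_fintype _).summable⟩
  have hlt : Real.exp (-t) < 1 := by
    rw [← Real.exp_zero]
    exact Real.exp_lt_exp.2 (by linarith)
  refine Summable.of_nonneg_of_le (fun n => (Real.exp_pos _).le) (fun n => ?_)
    (summable_geometric_of_lt_one (Real.exp_pos _).le hlt)
  rw [← Real.exp_nat_mul, Real.exp_le_exp]
  have h1 : (n : ℝ) ≤ level k₀ (k, n) := by
    rw [Nat.cast_le, level]
    change n ≤ 2 * n + _
    omega
  nlinarith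

end StarOU

end

/-! ### Conclusion: the semigroup on the star. -/

theorem proposition4p8 (m : ℕ) (hm : 0 < m) :
    ∃ T : ℝ → StarOU.StarL2 m →L[ℂ] StarOU.StarL2 m,
      StarOU.IsC₀Semigroup T ∧ StarOU.IsOUSemigroup T ∧ StarOU.IsGeneratedByA₂ T ∧
        ∀ t, 0 < t → StarOU.IsTraceClass (T t) := by
  let k₀ : Fin m := ⟨0, hm⟩
  obtain ⟨w, hw, hw'⟩ := StarOU.exists_adapted_basis k₀
  obtain ⟨b, hb⟩ := StarOU.exists_hermiteBasis hm k₀ w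
  have hlam : ∀ p : Fin m × ℕ, (0 : ℝ) ≤ (StarOU.level k₀ p : ℝ) := fun p => Nat.cast_nonneg _
  obtain ⟨T, hT⟩ := StarOU.exists_isDiagonalSemigroup b hlam
  have hval := hT.isGeneratorValue_iff hlam
  refine ⟨T, hT.isC₀Semigroup hlam, hT.isOUSemigroup hm k₀ w hw hw' hb, ⟨fun f => ⟨?_, ?_⟩, ?_⟩,
    fun t ht => hT.isTraceClass ht.le (StarOU.summable_exp_level k₀ ht)⟩
  · rintro ⟨g, hg⟩
    obtain ⟨f₁, f₂, h1, h2, h3, -⟩ :=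
      StarOU.exists_derivatives_of_coeff hm k₀ w hw hw' hb ((hval f g).1 hg)
    exact ⟨f₁, f₂, h1, h2, h3⟩
  · intro hf
    obtain ⟨g, hg⟩ := StarOU.exists_of_coeff b
      (StarOU.summable_of_mem_domain hm k₀ w hw hw' hb hf)
    exact ⟨g, (hval f g).2 hg⟩
  · intro f g hg
    obtain ⟨f₁, f₂, h1, -, -, h4⟩ :=
      StarOU.exists_derivatives_of_coeff hm k₀ w hw hw' hb ((hval f g).1 hg)
    exact ⟨f₁, f₂, h1, h4⟩
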